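/- An arithmetic circuit is a labeled finite directed acyclic graph whose vertices (gates) have fanin $0$ or $2$. Gates of fanin $0$ are labeled with the constant $-1$ or with a variable $X_i$, gates of fanin $2$ are labeled with $+$ or $\times$, and there is exactly one sink, called the output gate. The circuit computes a polynomial with integer coefficients in the obvious way: the polynomial of its output gate. A polynomial is multilinear if in each of its monomials every variable has exponent at most $1$ (in particular, the zero polynomial is multilinear). Let $\mathrm{ACIT}$ be the problem of deciding, given an arithmetic circuit $C$, whether the polynomial computed by $C$ is identically zero. Let $\mathrm{CheckML}$ be the problem of deciding, given an arithmetic circuit $C$, whether the polynomial computed by $C$ is multilinear. Then $\mathrm{CheckML}$ and $\mathrm{ACIT}$ are equivalent under logarithmic space many-one reductions: $\mathrm{CheckML}$ reduces to $\mathrm{ACIT}$, and $\mathrm{ACIT}$ reduces to $\mathrm{CheckML}$, in each case by a many-one reduction that is computable in logarithmic space. -/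

import Mathlib

/-! ## Arithmetic circuits -/

/-- A gate whose children, if it has any, are named by elements of `V`: an input gate labeled with
the constant `-1` or with a variable, or a computation gate of fanin `2`. -/
inductive Gate (V : Type) : Type
  | negOne : Gate V
  | var (i : ℕ) : Gate V
  | add (u w : V) : Gate V
  | mul (u w : V) : Gate V

/-- `g.HasChild u`: there is an edge from the gate named `u` into the gate `g`. -/
def Gate.HasChild {V : Type} : Gate V → V → Prop
  | .negOne, _ => False
  | .var _, _ => False
  | .add u w, x => x = u ∨ x = w
  | .mul u w, x => x = u ∨ x = w

/-- An arithmetic circuit: a finite directed graph with vertex set `Fin size`, labeled by gates,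
without directed cycles (for a finite graph this is well-foundedness of the child relation), that
has exactly one sink, its output gate. -/
structure ArithCircuit : Type where
  size : ℕ
  gate : Fin size → Gate (Fin size)
  acyclic : WellFounded fun u v : Fin size => (gate v).HasChild u
  output : Fin size
  isSink_iff : ∀ v, (∀ w, ¬ (gate w).HasChild v) ↔ v = output

namespace ArithCircuit

/-- The polynomial with integer coefficients computed by a gate of the circuit. -/
noncomputable def value (C : ArithCircuit) : Fin C.size → MvPolynomial ℕ ℤ :=
  C.acyclic.fix fun v ih =>
    match h : C.gate v with
    | .negOne => -1
    | .var i => MvPolynomial.X i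
    | .add u w => ih u (by simp [h, Gate.HasChild]) + ih w (by simp [h, Gate.HasChild])
    | .mul u w => ih u (by simp [h, Gate.HasChild]) * ih w (by simp [h, Gate.HasChild])

/-- The recursion that `value` satisfies. -/
theorem value_eq (C : ArithCircuit) (v : Fin C.size) :
    C.value v =
      match C.gate v with
      | .negOne => -1
      | .var i => MvPolynomial.X i
      | .add u w => C.value u + C.value w
      | .mul u w => C.value u * C.value w := by
  unfold value
  rw [WellFounded.fix_eq]
  split <;> rename_i h <;> simp [h]

/-- The polynomial computed by the circuit. -/
noncomputable def poly (C : ArithCircuit) : MvPolynomial ℕ ℤ := C.value C.output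

end ArithCircuit

/-! ## Circuits as words, and the two decision problems -/

/-- The alphabet over which circuits are written down. -/
inductive CircuitSymbol : Type
  | tally
  | endNum
  | negOne
  | var
  | add
  | mul

/-- Gate names and variable indices are written as a terminated tally string. -/
def encodeNum (k : ℕ) : List CircuitSymbol :=
  List.replicate k CircuitSymbol.tally ++ [CircuitSymbol.endNum]

/-- The word for one gate: its label, followed by the index of its variable or by the names of its
two children. -/
def encodeGate {n : ℕ} : Gate (Fin n) → List CircuitSymbol
  | .negOne => [CircuitSymbol.negOne]
  | .var i => CircuitSymbol.var :: encodeNum i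
  | .add u w => CircuitSymbol.add :: (encodeNum u ++ encodeNum w)
  | .mul u w => CircuitSymbol.mul :: (encodeNum u ++ encodeNum w)

/-- The word for a circuit: the name of the output gate, followed by the list of all gates. -/
def ArithCircuit.encode (C : ArithCircuit) : List CircuitSymbol :=
  encodeNum C.output ++ (List.ofFn fun v => encodeGate (C.gate v)).flatten

/-- A polynomial is multilinear if no variable has an exponent above `1` in any of its monomials. -/
def IsMultilinearPoly (p : MvPolynomial ℕ ℤ) : Prop :=
  ∀ m ∈ p.support, ∀ i, m i ≤ 1

/-- Arithmetic circuit identity testing: does the given circuit compute the zero polynomial? -/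
def ACIT : Language CircuitSymbol :=
  {w | ∃ C : ArithCircuit, C.encode = w ∧ C.poly = 0}

/-- Does the given circuit compute a multilinear polynomial? -/
def CheckML : Language CircuitSymbol :=
  {w | ∃ C : ArithCircuit, C.encode = w ∧ IsMultilinearPoly C.poly}

/-! ## Logarithmic space many-one reductions -/

/-- What an input head can see: the left end marker, a letter of the input, or the right end
marker. -/
inductive InputCell (α : Type) : Type
  | leftEnd
  | letter (a : α)
  | rightEnd

/-- Head movements. -/
inductive HeadMove : Type
  | left
  | stay
  | right

/-- The effect of a movement on a head position; a head at cell `0` cannot move further left. -/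
def HeadMove.apply : HeadMove → ℕ → ℕ
  | .left, p => p - 1
  | .stay, p => p
  | .right, p => p + 1

/-- A deterministic Turing machine with a two-way read-only input tape, finitely many read-write
work tapes, and a one-way write-only output tape. In one step it looks at its state, at the
scanned input cell and at the scanned work cells; it then either halts (`none`), or enters a new
state, moves the input head, writes on and moves on every work tape, and possibly emits one output
letter. -/
structure SpaceTransducer (α β : Type) : Type 1 where
  /-- the finite set of states -/
  State : Type
  stateFintype : Fintype State
  start : State
  /-- the finite work alphabet -/
  Work : Type
  workFintype : Fintype Work
  blank : Work
  /-- the number of work tapes -/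
  tapes : ℕ
  transition : State → InputCell α → (Fin tapes → Work) →
    Option (State × HeadMove × (Fin tapes → Work × HeadMove) × Option β)

namespace SpaceTransducer

variable {α β : Type}

/-- A configuration of the machine (the input word is kept separately). -/
structure Config (M : SpaceTransducer α β) : Type where
  state : M.State
  inputHead : ℕ
  workTape : Fin M.tapes → ℕ → M.Work
  workHead : Fin M.tapes → ℕ
  out : List β

/-- The initial configuration: blank work tapes, all heads at cell `0`, no output. -/
def init (M : SpaceTransducer α β) : M.Config where
  state := M.start
  inputHead := 0
  workTape := fun _ _ => M.blank
  workHead := fun _ => 0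
  out := []

/-- The input tape holds the left end marker in cell `0`, the letters of the input in the cells
`1, …, w.length`, and the right end marker in cell `w.length + 1`. -/
def inputCell (w : List α) : ℕ → InputCell α
  | 0 => .leftEnd
  | p + 1 =>
    match w[p]? with
    | some a => .letter a
    | none => .rightEnd

/-- One step on input `w`, or `none` if the machine halts. The input head never leaves the cells
`0, …, w.length + 1`. -/
def step (M : SpaceTransducer α β) (w : List α) (c : M.Config) : Option M.Config :=
  match M.transition c.state (inputCell w c.inputHead)
      (fun i => c.workTape i (c.workHead i)) with
  | none => none
  | some (q, d, act, o) =>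
    some
      { state := q
        inputHead := min (d.apply c.inputHead) (w.length + 1)
        workTape := fun i => Function.update (c.workTape i) (c.workHead i) (act i).1
        workHead := fun i => (act i).2.apply (c.workHead i)
        out := c.out ++ o.toList }

/-- `M.Reaches w c`: in the run on input `w` the configuration `c` occurs. -/
def Reaches (M : SpaceTransducer α β) (w : List α) (c : M.Config) : Prop :=
  StateTransition.Reaches (M.step w) M.init c

/-- On every input `w` the machine halts with output `f w`. -/
def Computes (M : SpaceTransducer α β) (f : List α → List β) : Prop :=
  ∀ w, ∃ c, M.Reaches w c ∧ M.step w c = none ∧ c.out = f w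

/-- On inputs of length `n`, every work head stays within the first `O(log n)` cells. (The added
constant covers short inputs.) -/
def UsesLogSpace (M : SpaceTransducer α β) : Prop :=
  ∃ k : ℕ, ∀ w c, M.Reaches w c → ∀ i, c.workHead i ≤ k * Nat.log 2 w.length + k

end SpaceTransducer

/-- A function on words is logspace computable if a Turing machine computes it in logarithmic
space; only the cells of the work tapes count. -/
def LogspaceComputable {α β : Type} (f : List α → List β) : Prop :=
  ∃ M : SpaceTransducer α β, M.Computes f ∧ M.UsesLogSpace

/-- Logspace many-one reducibility of languages. -/
def LogspaceReducible {α β : Type} (A : Language α) (B : Language β) : Prop :=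
  ∃ f : List α → List β, LogspaceComputable f ∧ ∀ w, w ∈ A ↔ f w ∈ B

/-- Equivalence of languages under logspace many-one reductions. -/
def LogspaceEquivalent {α β : Type} (A : Language α) (B : Language β) : Prop :=
  LogspaceReducible A B ∧ LogspaceReducible B A

/-! `ACIT` reduces to `CheckML` because `X₀² p` is multilinear exactly when `p = 0`
(`isMultilinearPoly_mul_X_sq_iff`); `squareGates` realises this product with three new gates.

For the converse, write `p|c` for the result of substituting `c` for `X_i`, and let `D_i(p) = (p -
p|0) + X_i (p|-1 - p|0)` (`linearityDefect`). If `p = a + X_i b` with `a`, `b` free of `X_i`, the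
brackets are `X_i b` and `-b`, so `D_i(p) = 0`. Conversely, every term of `D_i(p)` other than `p`
has degree at most one in `X_i`, so `D_i(p)` and `p` agree on all monomials in which `X_i` has
exponent at least two. Hence `p` is multilinear iff all `D_i(p)` vanish (`isMultilinearPoly_iff`).
Over the integers finitely many such identities merge into one, since a sum of squares vanishes only
if every summand does (`sum_sq_eq_zero_iff`). Indices are written in unary, so the input length `M`
exceeds every variable index that occurs, and the sum over `i < M` suffices. `defectGates` computes
it from three copies of the circuit for each `i`.

A word that is not a list of gates is recognised by one scan and sent to the empty word. Acyclicity
and uniqueness of the sink are not tested at all: both translations preserve and reflect them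
(`isCircuit_squareTable`, `DefectAddr.isCircuit_table`), so non-circuits go to non-circuits.
`mem_circuitLanguage_iff_of_translation` combines this with the uniqueness of the computed
polynomials.

The machines are built from two-exit fragments by branching, sequencing and loops, and are reasoned
about through `Exec` as programs on a few binary counters of size linear in the input length. New
gate names are affine in the old name and the counters, so they are written while the old name is
read. `Block.logspaceComputable` turns such a program into a logspace machine. -/

/-! ## Composable machine fragments -/

/-- The storage of a machine with `k` work tapes over `Option Bool`. -/
@[ext]
structure Mem (k : ℕ) (β : Type) : Type where
  pos : ℕ
  tape : Fin k → ℕ → Option Bool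
  head : Fin k → ℕ
  out : List β

/-- A machine fragment with two exits, `true` and `false`. -/
structure Block (k : ℕ) (α β : Type) : Type 1 where
  State : Type
  fintype : Fintype State
  start : State
  tr : State → InputCell α → (Fin k → Option Bool) →
    (State ⊕ Bool) × HeadMove × (Fin k → Option Bool × HeadMove) × Option β

namespace Block

variable {k : ℕ} {α β : Type}

/-- The effect of one action on the storage. -/
def act (w : List α) (m : Mem k β)
    (a : HeadMove × (Fin k → Option Bool × HeadMove) × Option β) : Mem k β where
  pos := min (a.1.apply m.pos) (w.length + 1)
  tape := fun i => Function.update (m.tape i) (m.head i) (a.2.1 i).1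
  head := fun i => (a.2.1 i).2.apply (m.head i)
  out := m.out ++ a.2.2.toList

/-- What the machine reads in storage `m`. -/
def look (B : Block k α β) (w : List α) (q : B.State) (m : Mem k β) :=
  B.tr q (SpaceTransducer.inputCell w m.pos) (fun i => m.tape i (m.head i))

/-- Started in state `q`, the fragment leaves through exit `b`, with no work head ever
beyond cell `L`. -/
inductive Run (B : Block k α β) (w : List α) (L : ℕ) :
    B.State → Mem k β → Bool → Mem k β → Prop
  | exit {q m b} (hm : ∀ i, m.head i ≤ L) (h : (B.look w q m).1 = Sum.inr b) :
      Run B w L q m b (act w m (B.look w q m).2)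
  | step {q m q' b m'} (hm : ∀ i, m.head i ≤ L) (h : (B.look w q m).1 = Sum.inl q')
      (hr : Run B w L q' (act w m (B.look w q m).2) b m') : Run B w L q m b m'

/-- `f` places `B` inside `B'`, and `ψ` says what becomes of the exits of `B`: an exit of `B'` here,
a state of `B'` in `Run.lift_cont`. The combinators `cond` and `whileDo` satisfy `h` by `rfl`. -/
theorem Run.lift_exit {B B' : Block k α β} {w : List α} {L : ℕ} (f : B.State → B'.State)
    (ψ : Bool → B'.State ⊕ Bool)
    (h : ∀ q c t, B'.tr (f q) c t = (Sum.elim (Sum.inl ∘ f) ψ (B.tr q c t).1, (B.tr q c t).2))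
    {q m b m'} (hr : B.Run w L q m b m') {b' : Bool} (hb : ψ b = Sum.inr b') :
    B'.Run w L (f q) m b' m' := by
  have hl : ∀ q m, B'.look w (f q) m =
      (Sum.elim (Sum.inl ∘ f) ψ (B.look w q m).1, (B.look w q m).2) := fun q m => h _ _ _
  induction hr with
  | @exit q m b hm he =>
    have := Run.exit (B := B') (w := w) (q := f q) (b := b') hm (by rw [hl, he]; simpa using hb)
    rwa [hl] at this
  | @step q m q' b m' hm he _ ih =>
    refine Run.step (q' := f q') hm (by rw [hl, he]; rfl) ?_
    rw [hl]
    exact ih hb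

theorem Run.lift_cont {B B' : Block k α β} {w : List α} {L : ℕ} (f : B.State → B'.State)
    (ψ : Bool → B'.State ⊕ Bool)
    (h : ∀ q c t, B'.tr (f q) c t = (Sum.elim (Sum.inl ∘ f) ψ (B.tr q c t).1, (B.tr q c t).2))
    {q m b m'} (hr : B.Run w L q m b m') {q' : B'.State} (hb : ψ b = Sum.inl q')
    {b' m''} (hc : B'.Run w L q' m' b' m'') : B'.Run w L (f q) m b' m'' := by
  have hl : ∀ q m, B'.look w (f q) m =
      (Sum.elim (Sum.inl ∘ f) ψ (B.look w q m).1, (B.look w q m).2) := fun q m => h _ _ _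
  induction hr with
  | @exit q m b hm he =>
    refine Run.step (q' := q') hm (by rw [hl, he]; simpa using hb) ?_
    rwa [hl]
  | @step q m q₁ b m' hm he _ ih =>
    refine Run.step (q' := f q₁) hm (by rw [hl, he]; rfl) ?_
    rw [hl]
    exact ih hb hc

/-- Run `A`, then `B` or `C`, depending on the exit of `A`. -/
def cond (A B C : Block k α β) : Block k α β where
  State := A.State ⊕ (B.State ⊕ C.State)
  fintype := by
    haveI := A.fintype; haveI := B.fintype; haveI := C.fintype
    infer_instance
  start := Sum.inl A.start
  tr := fun q c t =>
    match q with
    | .inl q => (Sum.elim (Sum.inl ∘ Sum.inl)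
        (fun b => Sum.inl (if b then .inr (.inl B.start) else .inr (.inr C.start)))
        (A.tr q c t).1, (A.tr q c t).2)
    | .inr (.inl q) => (Sum.elim (Sum.inl ∘ (Sum.inr ∘ Sum.inl)) Sum.inr
        (B.tr q c t).1, (B.tr q c t).2)
    | .inr (.inr q) => (Sum.elim (Sum.inl ∘ (Sum.inr ∘ Sum.inr)) Sum.inr
        (C.tr q c t).1, (C.tr q c t).2)

/-- While `A` exits through `true`, run `B`; leave through `true`. -/
def whileDo (A B : Block k α β) : Block k α β where
  State := A.State ⊕ B.State
  fintype := by
    haveI := A.fintype; haveI := B.fintype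
    infer_instance
  start := Sum.inl A.start
  tr := fun q c t =>
    match q with
    | .inl q => (Sum.elim (Sum.inl ∘ Sum.inl)
        (fun b => if b then .inl (.inr B.start) else .inr true)
        (A.tr q c t).1, (A.tr q c t).2)
    | .inr q => (Sum.elim (Sum.inl ∘ Sum.inr) (fun _ => .inl (.inl A.start))
        (B.tr q c t).1, (B.tr q c t).2)

/-- Run `A`, then `B`. -/
def seq (A B : Block k α β) : Block k α β := cond A B B

/-- Emit at most one letter, move the input head, and leave through an exit that depends on the
scanned cell. -/
def basic (f : InputCell α → Bool) (d : HeadMove) (o : Option β) : Block k α β where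
  State := Unit
  fintype := inferInstance
  start := ()
  tr := fun _ c t => (Sum.inr (f c), d, fun i => (t i, .stay), o)

/-! ### Binary counters -/

/-- The value of a list of binary digits, least significant digit first. -/
def bitsVal : List Bool → ℕ
  | [] => 0
  | b :: bs => b.toNat + 2 * bitsVal bs

/-- Digits on a tape, from cell `1` on. -/
def bitTape (bs : List Bool) : ℕ → Option Bool
  | 0 => none
  | p + 1 => bs[p]?

/-- The digits of the successor. -/
def incBits : List Bool → List Bool
  | [] => [true]
  | false :: bs => true :: bs
  | true :: bs => false :: incBits bs

theorem bitsVal_incBits (bs : List Bool) : bitsVal (incBits bs) = bitsVal bs + 1 := by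
  induction bs with
  | nil => rfl
  | cons b bs ih => cases b <;> simp [incBits, bitsVal, ih] <;> omega

/-- A new digit appears only when the carry runs through a list of ones, and then the successor is a
power of two. This ties the number of digits to the value and so bounds the tape. -/
theorem length_incBits (bs : List Bool) :
    (incBits bs).length = bs.length ∨
      ((incBits bs).length = bs.length + 1 ∧ bitsVal bs + 1 = 2 ^ bs.length) := by
  induction bs with
  | nil => right; simp [incBits, bitsVal]
  | cons b bs ih =>
    cases b
    · left; simp [incBits]
    · rcases ih with h | ⟨h, h'⟩
      · left; simp [incBits, h]
      · right; simp [incBits, h, bitsVal, pow_succ]; omega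

theorem bitTape_append (pre : List Bool) (b : Bool) (bs : List Bool) :
    bitTape (pre ++ b :: bs) (pre.length + 1) = some b := by
  simp [bitTape]

theorem bitTape_length (bs : List Bool) : bitTape bs (bs.length + 1) = none := by
  simp [bitTape]

theorem update_bitTape (pre : List Bool) (b b' : Bool) (bs : List Bool) :
    Function.update (bitTape (pre ++ b :: bs)) (pre.length + 1) (some b') =
      bitTape (pre ++ b' :: bs) := by
  funext p
  rcases p with _ | p
  · simp [bitTape, Function.update]
  · rcases lt_trichotomy p pre.length with h | h | h
    · simp [bitTape, Function.update, h.ne, List.getElem?_append_left h]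
    · subst h; simp [bitTape]
    · obtain ⟨j, rfl⟩ := Nat.exists_eq_add_of_lt h
      have h1 : pre.length + j + 1 ≠ pre.length := by omega
      have h2 : pre.length + j + 1 - pre.length = j + 1 := by omega
      simp [bitTape, Function.update, h1, h2,
        List.getElem?_append_right (show pre.length ≤ pre.length + j + 1 by omega)]

theorem update_bitTape_end (pre : List Bool) (b' : Bool) :
    Function.update (bitTape pre) (pre.length + 1) (some b') = bitTape (pre ++ [b']) := by
  funext p
  rcases p with _ | p
  · simp [bitTape, Function.update]
  · rcases lt_trichotomy p pre.length with h | h | h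
    · simp [bitTape, Function.update, h.ne, List.getElem?_append_left h]
    · subst h; simp [bitTape]
    · have : pre.length + 1 ≤ p := h
      simp [bitTape, Function.update, h.ne', List.getElem?_eq_none, h.le, this]

/-- Replace the contents and the head position of work tape `i`. -/
def _root_.Mem.set (m : Mem k β) (i : Fin k) (T : ℕ → Option Bool) (p : ℕ) : Mem k β :=
  { m with tape := Function.update m.tape i T, head := Function.update m.head i p }

/-- The action that touches only work tape `i`. -/
def touch (i : Fin k) (t : Fin k → Option Bool) (x : Option Bool) (d : HeadMove) :
    HeadMove × (Fin k → Option Bool × HeadMove) × Option β :=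
  (.stay, Function.update (fun j => (t j, .stay)) i (x, d), none)

theorem act_touch {w : List α} {m : Mem k β} (hpos : m.pos ≤ w.length + 1) (i : Fin k)
    (T : ℕ → Option Bool) (p : ℕ) (x : Option Bool) (d : HeadMove) :
    act w (m.set i T p)
      (touch i (fun j => (m.set i T p).tape j ((m.set i T p).head j)) x d) =
      m.set i (Function.update T p x) (d.apply p) := by
  ext1
  · simpa [act, touch, Mem.set, HeadMove.apply] using hpos
  · funext j
    by_cases h : j = i
    · subst h; simp [act, touch, Mem.set]
    · simp [act, touch, Mem.set, h]
  · funext j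
    by_cases h : j = i
    · subst h; simp [act, touch, Mem.set]
    · simp [act, touch, Mem.set, h, HeadMove.apply]
  · simp [act, touch, Mem.set]

/-- Phases of the counter operations. -/
inductive CtrPhase : Type
  | start
  | scan
  | back
  | undo
  deriving DecidableEq

instance : Fintype CtrPhase :=
  ⟨{.start, .scan, .back, .undo}, fun x => by cases x <;> simp⟩

/-- Increment counter `i`. -/
def inc (i : Fin k) : Block k α β where
  State := CtrPhase
  fintype := inferInstance
  start := .start
  tr := fun q _ t =>
    match q with
    | .start => (.inl .scan, touch i t (t i) .right)
    | .scan =>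
      match t i with
      | some true => (.inl .scan, touch i t (some false) .right)
      | _ => (.inl .back, touch i t (some true) .left)
    | .back =>
      match t i with
      | some b => (.inl .back, touch i t (some b) .left)
      | none => (.inr true, touch i t none .stay)
    | .undo => (.inr true, touch i t none .stay)

/-- Decrement counter `i` and leave through `true` if it is not zero; leave through `false`
otherwise. -/
def decNZ (i : Fin k) : Block k α β where
  State := CtrPhase
  fintype := inferInstance
  start := .start
  tr := fun q _ t =>
    match q with
    | .start => (.inl .scan, touch i t (t i) .right)
    | .scan =>
      match t i with
      | some false => (.inl .scan, touch i t (some true) .right)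
      | some true => (.inl .back, touch i t (some false) .left)
      | none => (.inl .undo, touch i t none .left)
    | .back =>
      match t i with
      | some b => (.inl .back, touch i t (some b) .left)
      | none => (.inr true, touch i t none .stay)
    | .undo =>
      match t i with
      | some _ => (.inl .undo, touch i t (some false) .left)
      | none => (.inr false, touch i t none .stay)

/-! ### Correctness of the binary counters. -/

section Counter

variable {w : List α} {L : ℕ} {m : Mem k β} {i : Fin k}

/-- Storage is kept in the form `m.set i T p` with `m` fixed, so that a run of many steps is an
induction on `T` and `p` alone. -/
theorem run_touch_step {B : Block k α β} (hpos : m.pos ≤ w.length + 1)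
    (hm : ∀ j, m.head j ≤ L) {q q' : B.State} {T T' : ℕ → Option Bool} {p p' : ℕ}
    {x : Option Bool} {d : HeadMove} (hp : p ≤ L)
    (h : ∀ c t, t i = T p → B.tr q c t = (.inl q', touch i t x d))
    (hT : Function.update T p x = T') (hd : d.apply p = p') {b m'}
    (hr : B.Run w L q' (m.set i T' p') b m') : B.Run w L q (m.set i T p) b m' := by
  have hl : B.look w q (m.set i T p) = _ := h _ _ (by simp [Mem.set])
  refine Run.step ?_ (by rw [hl]) ?_
  · intro j
    by_cases hj : j = i
    · subst hj; simpa [Mem.set] using hp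
    · simpa [Mem.set, hj] using hm j
  · rw [hl]
    simp only
    rwa [act_touch hpos, hT, hd]

theorem run_touch_exit {B : Block k α β} (hpos : m.pos ≤ w.length + 1)
    (hm : ∀ j, m.head j ≤ L) {q : B.State} {T : ℕ → Option Bool} {p : ℕ} {b : Bool}
    (hp : p ≤ L) (h : ∀ c t, t i = T p → B.tr q c t = (.inr b, touch i t (T p) .stay)) :
    B.Run w L q (m.set i T p) b (m.set i T p) := by
  have hl : B.look w q (m.set i T p) = _ := h _ _ (by simp [Mem.set])
  have := Run.exit (B := B) (w := w) (L := L) (q := q) (m := m.set i T p) (b := b) (by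
    intro j
    by_cases hj : j = i
    · subst hj; simpa [Mem.set] using hp
    · simpa [Mem.set, hj] using hm j) (by rw [hl])
  rw [hl] at this
  simp only at this
  rwa [act_touch hpos, Function.update_eq_self] at this

theorem bitTape_of_lt {bs : List Bool} {p : ℕ} (hp : p < bs.length) :
    bitTape bs (p + 1) = some bs[p] := by
  simp [bitTape, hp]

/-- Cell `0` of a `bitTape` is blank, which is how the walk to the left recognises its end. -/
theorem inc_back (hpos : m.pos ≤ w.length + 1) (hm : ∀ j, m.head j ≤ L) (bs : List Bool) (p : ℕ)
    (hp : p ≤ bs.length) (hL : p ≤ L) :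
    (inc (α := α) i).Run w L CtrPhase.back (m.set i (bitTape bs) p) true
      (m.set i (bitTape bs) 0) := by
  induction p with
  | zero =>
    exact run_touch_exit hpos hm hL fun c t ht => by
      simp only [inc]; rw [ht]; rfl
  | succ p ih =>
    refine run_touch_step hpos hm hL (q' := CtrPhase.back) (x := bitTape bs (p + 1)) (d := .left)
      (fun c t ht => ?_) (Function.update_eq_self _ _) rfl (ih (by omega) (by omega))
    rw [bitTape_of_lt (by omega)] at ht ⊢
    simp only [inc]; rw [ht]

theorem inc_scan (hpos : m.pos ≤ w.length + 1) (hm : ∀ j, m.head j ≤ L) (bs pre : List Bool)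
    (hL : pre.length + bs.length + 1 ≤ L) :
    (inc (α := α) i).Run w L CtrPhase.scan (m.set i (bitTape (pre ++ bs)) (pre.length + 1)) true
      (m.set i (bitTape (pre ++ incBits bs)) 0) := by
  induction bs generalizing pre with
  | nil =>
    refine run_touch_step hpos hm (by omega) (q' := CtrPhase.back) (x := some true) (d := .left)
      (fun c t ht => ?_) (by rw [List.append_nil, update_bitTape_end]; rfl) rfl
      (inc_back hpos hm _ _ (by simp [HeadMove.apply]) (by simp [HeadMove.apply]; omega))
    rw [List.append_nil, bitTape_length] at ht
    simp only [inc]; rw [ht]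
  | cons b bs ih =>
    simp only [List.length_cons] at hL
    cases b
    · refine run_touch_step hpos hm (by omega) (q' := CtrPhase.back) (x := some true) (d := .left)
        (fun c t ht => ?_) (by rw [update_bitTape]; rfl) rfl
        (inc_back hpos hm _ _ (by simp [HeadMove.apply]) (by simp [HeadMove.apply]; omega))
      rw [bitTape_append] at ht
      simp only [inc]; rw [ht]
    · refine run_touch_step hpos hm (by omega) (q' := CtrPhase.scan) (x := some false) (d := .right)
        (T' := bitTape ((pre ++ [false]) ++ bs)) (p' := (pre ++ [false]).length + 1)
        (fun c t ht => ?_) (by rw [update_bitTape]; simp) (by simp [HeadMove.apply]) ?_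
      · rw [bitTape_append] at ht
        simp only [inc]; rw [ht]
      · simpa [incBits] using ih (pre ++ [false]) (by simp; omega)

theorem inc_run (hpos : m.pos ≤ w.length + 1) (hm : ∀ j, m.head j ≤ L) (bs : List Bool)
    (hL : bs.length + 1 ≤ L) :
    (inc (α := α) i).Run w L CtrPhase.start (m.set i (bitTape bs) 0) true
      (m.set i (bitTape (incBits bs)) 0) := by
  refine run_touch_step hpos hm (by omega) (q' := CtrPhase.scan) (x := none) (d := .right)
    (fun c t ht => ?_) (Function.update_eq_self (f := bitTape bs) 0) rfl
    (inc_scan hpos hm bs [] (by simpa using hL))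
  simp only [inc]; rw [ht]; rfl

theorem decNZ_back (hpos : m.pos ≤ w.length + 1) (hm : ∀ j, m.head j ≤ L) (bs : List Bool) (p : ℕ)
    (hp : p ≤ bs.length) (hL : p ≤ L) :
    (decNZ (α := α) i).Run w L CtrPhase.back (m.set i (bitTape bs) p) true
      (m.set i (bitTape bs) 0) := by
  induction p with
  | zero =>
    exact run_touch_exit hpos hm hL fun c t ht => by
      simp only [decNZ]; rw [ht]; rfl
  | succ p ih =>
    refine run_touch_step hpos hm hL (q' := CtrPhase.back) (x := bitTape bs (p + 1)) (d := .left)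
      (fun c t ht => ?_) (Function.update_eq_self _ _) rfl (ih (by omega) (by omega))
    rw [bitTape_of_lt (by omega)] at ht ⊢
    simp only [decNZ]; rw [ht]

/-- This repairs a borrow that ran past the last digit: every digit met on the way back is
overwritten by zero, whatever it was. In the induction `suf` collects the digits already reset. -/
theorem decNZ_undo (hpos : m.pos ≤ w.length + 1) (hm : ∀ j, m.head j ≤ L) (pre suf : List Bool)
    (hL : pre.length ≤ L) :
    (decNZ (α := α) i).Run w L CtrPhase.undo (m.set i (bitTape (pre ++ suf)) pre.length) false
      (m.set i (bitTape (List.replicate pre.length false ++ suf)) 0) := by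
  induction pre using List.reverseRecOn generalizing suf with
  | nil =>
    exact run_touch_exit hpos hm (by simp) fun c t ht => by
      simp only [decNZ]; rw [ht]; rfl
  | append_singleton pre b ih =>
    simp only [List.length_append, List.length_singleton] at hL
    refine run_touch_step hpos hm (by simpa using hL) (q' := CtrPhase.undo) (x := some false)
      (d := .left) (T' := bitTape (pre ++ false :: suf)) (p' := pre.length)
      (fun c t ht => ?_) ?_ (by simp [HeadMove.apply]) ?_
    · simp only [List.length_append, List.length_singleton, List.append_assoc,
        List.singleton_append, bitTape_append] at ht
      simp only [decNZ]; rw [ht]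
    · simp only [List.length_append, List.length_singleton, List.append_assoc,
        List.singleton_append, update_bitTape]
    · simpa [List.replicate_succ'] using ih (false :: suf) (by omega)

/-- Either the borrow finds no `true`, and the value was zero, or it stops at the first one. Leading
zeros are never removed, so the number of digits stays the same in both cases. -/
theorem decNZ_scan (hpos : m.pos ≤ w.length + 1) (hm : ∀ j, m.head j ≤ L) (bs pre : List Bool)
    (hL : pre.length + bs.length + 1 ≤ L) :
    (bitsVal bs = 0 ∧
      (decNZ (α := α) i).Run w L CtrPhase.scan (m.set i (bitTape (pre ++ bs)) (pre.length + 1)) false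
        (m.set i (bitTape (List.replicate (pre.length + bs.length) false)) 0)) ∨
    ∃ bs', bs'.length = bs.length ∧ bitsVal bs = bitsVal bs' + 1 ∧
      (decNZ (α := α) i).Run w L CtrPhase.scan (m.set i (bitTape (pre ++ bs)) (pre.length + 1)) true
        (m.set i (bitTape (pre ++ bs')) 0) := by
  induction bs generalizing pre with
  | nil =>
    refine Or.inl ⟨rfl, run_touch_step hpos hm (by omega) (q' := CtrPhase.undo) (x := none)
      (d := .left) (T' := bitTape (pre ++ [])) (p' := pre.length) (fun c t ht => ?_) ?_ rfl ?_⟩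
    · rw [List.append_nil, bitTape_length] at ht
      simp only [decNZ]; rw [ht]
    · simp [← bitTape_length pre]
    · simpa using decNZ_undo hpos hm pre [] (by omega)
  | cons b bs ih =>
    simp only [List.length_cons] at hL
    cases b
    · have key : ∀ {b m'}, (decNZ (α := α) i).Run w L CtrPhase.scan
          (m.set i (bitTape ((pre ++ [true]) ++ bs)) ((pre ++ [true]).length + 1)) b m' →
          (decNZ (α := α) i).Run w L CtrPhase.scan
          (m.set i (bitTape (pre ++ false :: bs)) (pre.length + 1)) b m' := fun h => by
        refine run_touch_step hpos hm (by omega) (q' := CtrPhase.scan) (x := some true)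
          (d := .right) (fun c t ht => ?_) (by rw [update_bitTape]; simp)
          (by simp [HeadMove.apply]) h
        rw [bitTape_append] at ht
        simp only [decNZ]; rw [ht]
      rcases ih (pre ++ [true]) (by simp; omega) with ⟨h0, h⟩ | ⟨bs', hl, hv, h⟩
      · refine Or.inl ⟨by simp [bitsVal, h0], ?_⟩
        convert key h using 4
        simp; omega
      · refine Or.inr ⟨true :: bs', by simp [hl], by simp [bitsVal, hv]; omega, ?_⟩
        simpa using key h
    · refine Or.inr ⟨false :: bs, rfl, by simp [bitsVal]; omega, ?_⟩
      refine run_touch_step hpos hm (by omega) (q' := CtrPhase.back) (x := some false) (d := .left)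
        (fun c t ht => ?_) (by rw [update_bitTape]) rfl
        (decNZ_back hpos hm _ _ (by simp [HeadMove.apply]) (by simp [HeadMove.apply]; omega))
      rw [bitTape_append] at ht
      simp only [decNZ]; rw [ht]

theorem bitsVal_replicate_false (n : ℕ) : bitsVal (List.replicate n false) = 0 := by
  induction n with
  | zero => rfl
  | succ n ih => simp [List.replicate_succ, bitsVal, ih]

theorem decNZ_run (hpos : m.pos ≤ w.length + 1) (hm : ∀ j, m.head j ≤ L) (bs : List Bool)
    (hL : bs.length + 1 ≤ L) :
    ∃ bs', bs'.length = bs.length ∧ bitsVal bs' = bitsVal bs - 1 ∧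
      (decNZ (α := α) i).Run w L CtrPhase.start (m.set i (bitTape bs) 0)
        (decide (bitsVal bs ≠ 0)) (m.set i (bitTape bs') 0) := by
  have key : ∀ {b m'}, (decNZ (α := α) i).Run w L CtrPhase.scan (m.set i (bitTape bs) 1) b m' →
      (decNZ (α := α) i).Run w L CtrPhase.start (m.set i (bitTape bs) 0) b m' := fun h => by
    refine run_touch_step hpos hm (by omega) (q' := CtrPhase.scan) (x := none) (d := .right)
      (fun c t ht => ?_) (Function.update_eq_self (f := bitTape bs) 0) rfl h
    simp only [decNZ]; rw [ht]; rfl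
  rcases decNZ_scan hpos hm (i := i) bs [] (by simpa using hL) with ⟨h0, h⟩ | ⟨bs', hl, hv, h⟩
  · exact ⟨List.replicate bs.length false, by simp, by rw [bitsVal_replicate_false, h0], by simpa [h0] using key h⟩
  · exact ⟨bs', hl, by omega, by simpa [hv] using key h⟩

end Counter

/-! ### Executions on counter values -/

/-- The storage seen as counter values. -/
@[ext]
structure _root_.CtrState (k : ℕ) (β : Type) : Type where
  pos : ℕ
  ctr : Fin k → ℕ
  out : List β

/-- `m` stores the state `s` with at most `Nat.size bd` digits per counter. -/
def Represents (w : List α) (bd : ℕ) (m : Mem k β) (s : CtrState k β) : Prop :=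
  m.pos ≤ w.length + 1 ∧ m.pos = s.pos ∧ m.out = s.out ∧ ∀ i, m.head i = 0 ∧
    ∃ bs, m.tape i = bitTape bs ∧ bitsVal bs = s.ctr i ∧ bs.length ≤ bd.size

/-- The fragment transforms the state `s` into `s'` and leaves through exit `b`. -/
def Exec (B : Block k α β) (w : List α) (bd : ℕ) (s : CtrState k β) (b : Bool)
    (s' : CtrState k β) : Prop :=
  ∀ m, Represents w bd m s → ∃ m', B.Run w (bd.size + 1) B.start m b m' ∧ Represents w bd m' s'

section Exec

variable {w : List α} {bd : ℕ} {A B C : Block k α β} {s s₁ s₂ : CtrState k β} {b b' : Bool}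

theorem Exec.cond_true (hA : A.Exec w bd s true s₁) (hB : B.Exec w bd s₁ b s₂) :
    (cond A B C).Exec w bd s b s₂ := by
  intro m hm
  obtain ⟨m₁, h₁, r₁⟩ := hA m hm
  obtain ⟨m₂, h₂, r₂⟩ := hB m₁ r₁
  refine ⟨m₂, ?_, r₂⟩
  refine Run.lift_cont (B' := cond A B C) (q' := .inr (.inl B.start)) Sum.inl _
    (fun _ _ _ => rfl) h₁ rfl ?_
  exact Run.lift_exit (B' := cond A B C) (Sum.inr ∘ Sum.inl) Sum.inr (fun _ _ _ => rfl) h₂ rfl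

theorem Exec.cond_false (hA : A.Exec w bd s false s₁) (hC : C.Exec w bd s₁ b s₂) :
    (cond A B C).Exec w bd s b s₂ := by
  intro m hm
  obtain ⟨m₁, h₁, r₁⟩ := hA m hm
  obtain ⟨m₂, h₂, r₂⟩ := hC m₁ r₁
  refine ⟨m₂, ?_, r₂⟩
  refine Run.lift_cont (B' := cond A B C) (q' := .inr (.inr C.start)) Sum.inl _
    (fun _ _ _ => rfl) h₁ rfl ?_
  exact Run.lift_exit (B' := cond A B C) (Sum.inr ∘ Sum.inr) Sum.inr (fun _ _ _ => rfl) h₂ rfl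

theorem Exec.seq (hA : A.Exec w bd s b' s₁) (hB : B.Exec w bd s₁ b s₂) :
    (seq A B).Exec w bd s b s₂ := by
  cases b'
  · exact hA.cond_false hB
  · exact hA.cond_true hB

theorem Exec.whileDo_false (hA : A.Exec w bd s false s₁) :
    (whileDo A B).Exec w bd s true s₁ := by
  intro m hm
  obtain ⟨m₁, h₁, r₁⟩ := hA m hm
  exact ⟨m₁, Run.lift_exit (B' := whileDo A B) Sum.inl _ (fun _ _ _ => rfl) h₁ rfl, r₁⟩

theorem Exec.whileDo_true {s₃ : CtrState k β} (hA : A.Exec w bd s true s₁)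
    (hB : B.Exec w bd s₁ b' s₂) (h : (whileDo A B).Exec w bd s₂ b s₃) :
    (whileDo A B).Exec w bd s b s₃ := by
  intro m hm
  obtain ⟨m₁, h₁, r₁⟩ := hA m hm
  obtain ⟨m₂, h₂, r₂⟩ := hB m₁ r₁
  obtain ⟨m₃, h₃, r₃⟩ := h m₂ r₂
  refine ⟨m₃, ?_, r₃⟩
  refine Run.lift_cont (B' := whileDo A B) (q' := .inr B.start) Sum.inl _
    (fun _ _ _ => rfl) h₁ rfl ?_
  exact Run.lift_cont (B' := whileDo A B) (q' := .inl A.start) Sum.inr _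
    (fun _ _ _ => rfl) h₂ rfl h₃

theorem exec_basic (f : InputCell α → Bool) (d : HeadMove) (o : Option β) :
    (basic f d o).Exec w bd s (f (SpaceTransducer.inputCell w s.pos))
      ⟨min (d.apply s.pos) (w.length + 1), s.ctr, s.out ++ o.toList⟩ := by
  rintro m ⟨h, hp, ho, hc⟩
  refine ⟨_, Run.exit (fun i => by simp [(hc i).1]) (by simp [look, basic, hp]), ?_⟩
  refine ⟨by simp [act, look, basic], by simp [act, look, basic, hp],
    by simp [act, look, basic, ho], fun i => ?_⟩
  obtain ⟨h0, bs, h1, h2, h3⟩ := hc i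
  exact ⟨by simp [act, look, basic, HeadMove.apply, h0], bs, by simp [act, look, basic, h1], h2, h3⟩

theorem _root_.Mem.set_self (m : Mem k β) (i : Fin k) : m.set i (m.tape i) (m.head i) = m := by
  simp [Mem.set]

theorem exec_inc (i : Fin k) (h : s.ctr i + 1 ≤ bd) :
    (inc (α := α) i).Exec w bd s true
      ⟨s.pos, Function.update s.ctr i (s.ctr i + 1), s.out⟩ := by
  rintro m ⟨hw, hp, ho, hc⟩
  obtain ⟨h0, bs, h1, h2, h3⟩ := hc i
  have hrun := inc_run (m := m) (i := i) (L := bd.size + 1) hw (fun j => by simp [(hc j).1]) bs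
    (by omega)
  rw [← h1, ← h0, Mem.set_self] at hrun
  refine ⟨_, hrun, hw, hp, ho, fun j => ?_⟩
  by_cases hj : j = i
  · subst hj
    refine ⟨by simp [Mem.set, h0], incBits bs, by simp [Mem.set], by
      simp [bitsVal_incBits, h2], ?_⟩
    rcases length_incBits bs with hl | ⟨hl, hv⟩
    · omega
    · rw [hl]
      -- The list has grown, so `2 ^ bs.length = s.ctr i + 1 ≤ bd`, and there was still room for a
      -- digit.
      exact Nat.lt_size.2 (by rw [← hv, h2]; exact h)
  · simpa [Mem.set, hj] using hc j

theorem exec_decNZ (i : Fin k) :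
    (decNZ (α := α) i).Exec w bd s (decide (s.ctr i ≠ 0))
      ⟨s.pos, Function.update s.ctr i (s.ctr i - 1), s.out⟩ := by
  rintro m ⟨hw, hp, ho, hc⟩
  obtain ⟨h0, bs, h1, h2, h3⟩ := hc i
  obtain ⟨bs', hl, hv, hrun⟩ := decNZ_run (m := m) (i := i) (L := bd.size + 1) hw
    (fun j => by simp [(hc j).1]) bs (by omega)
  rw [← h1, h2] at hrun
  nth_rw 1 [← h0] at hrun
  rw [Mem.set_self] at hrun
  refine ⟨_, hrun, hw, hp, ho, fun j => ?_⟩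
  by_cases hj : j = i
  · subst hj
    exact ⟨by simp [Mem.set], bs', by simp [Mem.set], by simp [hv, h2], by omega⟩
  · simpa [Mem.set, hj] using hc j

end Exec

/-! ### From fragments to machines -/

/-- The machine that runs a fragment and then halts. -/
def toMachine (B : Block k α β) : SpaceTransducer α β where
  State := Option B.State
  stateFintype := by haveI := B.fintype; infer_instance
  start := some B.start
  Work := Option Bool
  workFintype := inferInstance
  blank := none
  tapes := k
  transition := fun q c t => q.map fun q => ((B.tr q c t).1.getLeft?, (B.tr q c t).2)

/-- The configuration of the machine of a fragment. -/
def config (B : Block k α β) (q : Option B.State) (m : Mem k β) : B.toMachine.Config :=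
  ⟨q, m.pos, m.tape, m.head, m.out⟩

theorem step_config (B : Block k α β) (w : List α) (q : B.State) (m : Mem k β) :
    B.toMachine.step w (B.config (some q) m) =
      some (B.config (B.look w q m).1.getLeft? (act w m (B.look w q m).2)) := rfl

theorem step_config_none (B : Block k α β) (w : List α) (m : Mem k β) :
    B.toMachine.step w (B.config none m) = none := rfl

theorem Run.reaches {B : Block k α β} {w : List α} {L : ℕ} {q m b m'}
    (h : B.Run w L q m b m') :
    StateTransition.Reaches (B.toMachine.step w) (B.config (some q) m) (B.config none m') := by
  induction h with
  | @exit q m b hm h =>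
    refine Relation.ReflTransGen.single ?_
    rw [step_config, h]; rfl
  | @step q m q' b m' hm h _ ih =>
    refine Relation.ReflTransGen.head ?_ ih
    rw [step_config, h]; rfl

/-- Steps are deterministic, so a reachable configuration lies on the run or is the halted one at
its end. `Run` bounds the heads only before each action, hence the extra hypothesis `hm'` for the
end. -/
theorem Run.head_le {B : Block k α β} {w : List α} {L : ℕ} {q m b m'}
    (h : B.Run w L q m b m') (hm' : ∀ i, m'.head i ≤ L) {c : B.toMachine.Config}
    (hc : StateTransition.Reaches (B.toMachine.step w) (B.config (some q) m) c) (i : Fin k) :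
    c.workHead i ≤ L := by
  induction h with
  | @exit q m b hm h =>
    rcases Relation.ReflTransGen.cases_head hc with rfl | ⟨d, hd, hdc⟩
    · exact hm i
    · rw [step_config, h] at hd
      cases hd
      rcases Relation.ReflTransGen.cases_head hdc with rfl | ⟨e, he, -⟩
      · exact hm' i
      · cases he
  | @step q m q' b m' hm h _ ih =>
    rcases Relation.ReflTransGen.cases_head hc with rfl | ⟨d, hd, hdc⟩
    · exact hm i
    · rw [step_config, h] at hd
      cases hd
      exact ih hm' hdc

/-- A fragment whose counters stay below `|w| + 2` computes in logarithmic space. -/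
theorem logspaceComputable (B : Block k α β) (f : List α → List β)
    (h : ∀ w, ∃ b s, B.Exec w (w.length + 2) ⟨0, 0, []⟩ b s ∧ s.out = f w) :
    LogspaceComputable f := by
  have key : ∀ w, ∃ b m', B.Run w ((w.length + 2).size + 1) B.start
      ⟨0, fun _ _ => none, fun _ => 0, []⟩ b m' ∧ (∀ i, m'.head i = 0) ∧ m'.out = f w := by
    intro w
    obtain ⟨b, s, hs, ho⟩ := h w
    -- A blank tape represents zero by the empty list of digits.
    obtain ⟨m', hr, -, -, hm, hh⟩ := hs ⟨0, fun _ _ => none, fun _ => 0, []⟩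
      ⟨by simp, rfl, rfl, fun i => ⟨rfl, [], by funext p; cases p <;> rfl, rfl, by simp⟩⟩
    exact ⟨b, m', hr, fun i => (hh i).1, hm.trans ho⟩
  refine ⟨B.toMachine, fun w => ?_, 4, fun w c hc i => ?_⟩
  · obtain ⟨b, m', hr, -, ho⟩ := key w
    exact ⟨_, hr.reaches, step_config_none B w m', ho⟩
  · obtain ⟨b, m', hr, hh, -⟩ := key w
    refine (hr.head_le (fun i => by simp [hh]) hc i).trans ?_
    -- Together with the one extra cell allowed by `Exec`, this accounts for the constant `4`.
    have h1 : (w.length + 2).size ≤ Nat.log 2 w.length + 3 := by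
      rw [Nat.size_le]
      have h2 := Nat.lt_pow_succ_log_self (b := 2) (by norm_num) w.length
      have h3 : 1 ≤ 2 ^ Nat.log 2 w.length := Nat.one_le_two_pow
      simp only [pow_succ] at h2 ⊢
      omega
    omega

end Block

/-! ## Circuits as partial gate tables -/

namespace Gate

variable {V W : Type}

/-- Rename the children of a gate. -/
def map (f : V → W) : Gate V → Gate W
  | .negOne => .negOne
  | .var i => .var i
  | .add u w => .add (f u) (f w)
  | .mul u w => .mul (f u) (f w)

/-- The polynomial of a gate, given those of its children. -/
noncomputable def eval (val : V → MvPolynomial ℕ ℤ) : Gate V → MvPolynomial ℕ ℤ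
  | .negOne => -1
  | .var i => MvPolynomial.X i
  | .add u w => val u + val w
  | .mul u w => val u * val w

theorem hasChild_map (f : V → W) (g : Gate V) (x : W) :
    (g.map f).HasChild x ↔ ∃ u, g.HasChild u ∧ f u = x := by
  cases g <;> simp [map, HasChild, or_and_right, exists_or, eq_comm]

theorem eval_map (f : V → W) (g : Gate V) (val : W → MvPolynomial ℕ ℤ) :
    (g.map f).eval val = g.eval (val ∘ f) := by
  cases g <;> rfl

theorem eval_congr {g : Gate V} {val val' : V → MvPolynomial ℕ ℤ}
    (h : ∀ u, g.HasChild u → val u = val' u) : g.eval val = g.eval val' := by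
  cases g <;> simp_all [eval, HasChild]

end Gate

namespace GateTable

variable {V W : Type}

/-- The gate `v` of the table `P` has the child `u`. -/
def Edge (P : V → Option (Gate V)) (u v : V) : Prop := ∃ g, P v = some g ∧ g.HasChild u

/-- The table describes an arithmetic circuit with output gate `out`. -/
structure IsCircuit (P : V → Option (Gate V)) (out : V) : Prop where
  closed : ∀ u v, Edge P u v → P u ≠ none
  wf : WellFounded (Edge P)
  sink : ∀ v, P v ≠ none → (∀ w, ¬ Edge P v w) → v = out
  out_mem : P out ≠ none

/-- The table of a list of gates. -/
def listTable (gs : List (Gate ℕ)) (v : ℕ) : Option (Gate ℕ) := gs[v]?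

/-- `val` assigns to every gate of the table the polynomial that it computes. -/
def IsValuation (P : V → Option (Gate V)) (val : V → MvPolynomial ℕ ℤ) : Prop :=
  ∀ v g, P v = some g → val v = g.eval val

/-- Well-founded induction along the edges, where closedness keeps the children inside the table. It
therefore suffices to exhibit some valuation of a translated table. -/
theorem IsValuation.unique {P : V → Option (Gate V)} {out : V} (hP : IsCircuit P out)
    {val val' : V → MvPolynomial ℕ ℤ} (h : IsValuation P val) (h' : IsValuation P val') (v : V)
    (hv : P v ≠ none) : val v = val' v := by
  induction v using hP.wf.induction with
  | _ v ih =>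
    obtain ⟨g, hg⟩ := Option.ne_none_iff_exists'.1 hv
    rw [h v g hg, h' v g hg]
    exact Gate.eval_congr fun u hu => ih u ⟨g, hg, hu⟩ (hP.closed u v ⟨g, hg, hu⟩)

/-! ### Invariance under renaming of gates. -/

section Transport

variable (e : V ≃ W) {P : V → Option (Gate V)} {Q : W → Option (Gate W)}

theorem edge_transport (hQ : ∀ v, Q (e v) = (P v).map (Gate.map e)) (u v : V) :
    Edge Q (e u) (e v) ↔ Edge P u v := by
  simp [Edge, hQ, Gate.hasChild_map]

/-- Tables are defined on a whole type, with `none` for absent gates. A renumbering is then a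
bijection of types and no range conditions arise. -/
theorem isCircuit_transport (hQ : ∀ v, Q (e v) = (P v).map (Gate.map e)) (out : V) :
    IsCircuit Q (e out) ↔ IsCircuit P out := by
  have hn : ∀ v, Q (e v) ≠ none ↔ P v ≠ none := fun v => by simp [hQ]
  have hE := edge_transport e hQ
  have hwf : WellFounded (Edge Q) ↔ WellFounded (Edge P) :=
    ⟨fun h => (RelIso.mk e (hE _ _) : Edge P ≃r Edge Q).toRelEmbedding.wellFounded h,
      fun h => (RelIso.mk e (hE _ _) : Edge P ≃r Edge Q).symm.toRelEmbedding.wellFounded h⟩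
  constructor
  · rintro ⟨h1, h2, h3, h4⟩
    refine ⟨fun u v h => (hn u).1 (h1 _ _ ((hE u v).2 h)), hwf.1 h2, fun v hv h => ?_, (hn _).1 h4⟩
    refine e.injective (h3 _ ((hn v).2 hv) fun w hw => ?_)
    obtain ⟨w, rfl⟩ := e.surjective w
    exact h w ((hE _ _).1 hw)
  · rintro ⟨h1, h2, h3, h4⟩
    refine ⟨e.surjective.forall₂.2 fun u v h => (hn u).2 (h1 _ _ ((hE u v).1 h)), hwf.2 h2,
      e.surjective.forall.2 fun v hv h => ?_, (hn _).2 h4⟩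
    rw [h3 v ((hn v).1 hv) fun w hw => h (e w) ((hE _ _).2 hw)]

theorem isValuation_transport (hQ : ∀ v, Q (e v) = (P v).map (Gate.map e))
    {val : V → MvPolynomial ℕ ℤ} (h : IsValuation P val) :
    IsValuation Q (val ∘ e.symm) := by
  refine e.surjective.forall.2 fun v g hg => ?_
  rw [hQ] at hg
  obtain ⟨g, hg', rfl⟩ := Option.map_eq_some_iff.1 hg
  rw [Gate.eval_map, Function.comp_apply, e.symm_apply_apply, h v g hg']
  congr 1
  funext u
  simp

end Transport

end GateTable

/-! ## Words of gate lists -/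

/-- The word for one gate with children named by natural numbers. -/
def encodeNatGate : Gate ℕ → List CircuitSymbol
  | .negOne => [CircuitSymbol.negOne]
  | .var i => CircuitSymbol.var :: encodeNum i
  | .add u w => CircuitSymbol.add :: (encodeNum u ++ encodeNum w)
  | .mul u w => CircuitSymbol.mul :: (encodeNum u ++ encodeNum w)

/-- The word for an output name and a list of gates. -/
def encodeGates (o : ℕ) (gs : List (Gate ℕ)) : List CircuitSymbol :=
  encodeNum o ++ gs.flatMap encodeNatGate

/-- The terminator makes numbers self-delimiting; unique readability of all circuit words rests on
this. -/
theorem encodeNum_append_inj {a b : ℕ} {x y : List CircuitSymbol}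
    (h : encodeNum a ++ x = encodeNum b ++ y) : a = b ∧ x = y := by
  induction a generalizing b with
  | zero => cases b <;> simp_all [encodeNum, List.replicate_succ]
  | succ a ih =>
    cases b with
    | zero => simp [encodeNum, List.replicate_succ] at h
    | succ b =>
      have : encodeNum a ++ x = encodeNum b ++ y := by
        simpa [encodeNum, List.replicate_succ] using h
      simpa using ih this

theorem encodeNatGate_append_inj {g g' : Gate ℕ} {x y : List CircuitSymbol}
    (h : encodeNatGate g ++ x = encodeNatGate g' ++ y) : g = g' ∧ x = y := by
  cases g <;> cases g' <;> simp [encodeNatGate] at h ⊢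
  · exact h
  · exact encodeNum_append_inj h
  all_goals
    obtain ⟨rfl, h'⟩ := encodeNum_append_inj h
    obtain ⟨rfl, rfl⟩ := encodeNum_append_inj h'
    simp

theorem flatMap_encodeNatGate_inj {gs gs' : List (Gate ℕ)}
    (h : gs.flatMap encodeNatGate = gs'.flatMap encodeNatGate) : gs = gs' := by
  have hne : ∀ g, encodeNatGate g ≠ [] := fun g => by cases g <;> simp [encodeNatGate]
  induction gs generalizing gs' with
  | nil => cases gs' <;> simp_all
  | cons g gs ih =>
    cases gs' with
    | nil => simp_all
    | cons g' gs' =>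
      simp only [List.flatMap_cons] at h
      obtain ⟨rfl, h'⟩ := encodeNatGate_append_inj h
      rw [ih h']

theorem encodeGates_inj {o o' : ℕ} {gs gs' : List (Gate ℕ)}
    (h : encodeGates o gs = encodeGates o' gs') : o = o' ∧ gs = gs' := by
  obtain ⟨h1, h2⟩ := encodeNum_append_inj h
  exact ⟨h1, flatMap_encodeNatGate_inj h2⟩

namespace ArithCircuit

/-- The gates of a circuit, with children named by natural numbers. -/
def gateList (C : ArithCircuit) : List (Gate ℕ) :=
  List.ofFn fun v => (C.gate v).map Fin.val

theorem encode_eq (C : ArithCircuit) : C.encode = encodeGates C.output C.gateList := by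
  have : ∀ g : Gate (Fin C.size), encodeNatGate (g.map Fin.val) = encodeGate g := fun g => by
    cases g <;> rfl
  simp [encode, encodeGates, gateList, List.flatMap, List.map_ofFn, Function.comp_def, this]

open GateTable

theorem gateList_getElem? (C : ArithCircuit) (v : Fin C.size) :
    listTable C.gateList v = some ((C.gate v).map Fin.val) := by
  simp [gateList, listTable]

theorem gateList_eq_some {C : ArithCircuit} {v : ℕ} {g : Gate ℕ} (h : listTable C.gateList v = some g) :
    ∃ v' : Fin C.size, (v' : ℕ) = v ∧ g = (C.gate v').map Fin.val := by
  obtain ⟨hv, rfl⟩ := List.getElem?_eq_some_iff.1 h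
  exact ⟨⟨v, by simpa [gateList] using hv⟩, rfl, by simp [gateList]⟩

theorem isCircuit_gateList (C : ArithCircuit) :
    IsCircuit (listTable C.gateList) C.output := by
  have hE : ∀ u v, Edge (listTable C.gateList) u v →
      ∃ u' v' : Fin C.size, (u' : ℕ) = u ∧ (v' : ℕ) = v ∧ (C.gate v').HasChild u' := by
    rintro u v ⟨g, hg, hu⟩
    obtain ⟨v', hv, rfl⟩ := gateList_eq_some hg
    obtain ⟨u', hu', rfl⟩ := (Gate.hasChild_map _ _ _).1 hu
    exact ⟨u', v', rfl, hv, hu'⟩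
  have hacc : ∀ v : Fin C.size, Acc (Edge (listTable C.gateList)) (v : ℕ) := fun v => by
    induction v using C.acyclic.induction with
    | _ v ih =>
      refine ⟨_, fun u hu => ?_⟩
      obtain ⟨u', v', rfl, hv, h⟩ := hE _ _ hu
      exact ih u' (Fin.ext hv ▸ h)
  refine ⟨fun u v h => ?_, ⟨fun v => ⟨_, fun u hu => ?_⟩⟩, fun v hv h => ?_, ?_⟩
  · obtain ⟨u', v', rfl, -, -⟩ := hE _ _ h
    simp [gateList_getElem?]
  · obtain ⟨u', v', rfl, -, -⟩ := hE _ _ hu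
    exact hacc u'
  · obtain ⟨g, hg⟩ := Option.ne_none_iff_exists'.1 hv
    obtain ⟨v', rfl, rfl⟩ := gateList_eq_some hg
    rw [(C.isSink_iff v').1 fun w hw => h w ⟨_, C.gateList_getElem? w,
      (Gate.hasChild_map _ _ _).2 ⟨_, hw, rfl⟩⟩]
  · simp [gateList_getElem?]

theorem exists_isValuation (C : ArithCircuit) :
    ∃ val, IsValuation (listTable C.gateList) val ∧ val C.output = C.poly := by
  refine ⟨fun v => if h : v < C.size then C.value ⟨v, h⟩ else 0, fun v g hg => ?_, by simp [poly]⟩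
  obtain ⟨v, rfl, rfl⟩ := gateList_eq_some hg
  rw [Gate.eval_map]
  simp only [Fin.is_lt, dite_true, Fin.eta]
  rw [value_eq]
  cases C.gate v <;> simp [Gate.eval]

/-- A nonempty finite acyclic graph has a sink. -/
theorem _root_.WellFounded.exists_sink {V : Type} [Finite V] [Nonempty V] {r : V → V → Prop}
    (h : WellFounded r) : ∃ v, ∀ w, ¬ r v w := by
  have : IsTrans V (fun a b => Relation.TransGen r b a) := ⟨fun a b c hab hbc => hbc.trans hab⟩
  have : Std.Irrefl (fun a b => Relation.TransGen r b a) :=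
    ⟨fun a ha => h.transGen.irrefl.irrefl a ha⟩
  obtain ⟨v, -, hv⟩ := (Finite.wellFounded_of_trans_of_irrefl
    (fun a b => Relation.TransGen r b a)).has_min Set.univ ⟨Classical.arbitrary V, trivial⟩
  exact ⟨v, fun w hw => hv w trivial (.single hw)⟩

/-- Closedness puts all children in range. `IsCircuit` only says that every sink is the output; that
the output is a sink follows because a nonempty finite acyclic graph has some sink. -/
theorem _root_.GateTable.IsCircuit.exists_circuit {o : ℕ} {gs : List (Gate ℕ)}
    (h : IsCircuit (listTable gs) o) : ∃ C : ArithCircuit, C.encode = encodeGates o gs := by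
  have hex : ∀ v : Fin gs.length, ∃ g : Gate (Fin gs.length), g.map Fin.val = gs[v] := by
    intro v
    have hlt : ∀ u, gs[v].HasChild u → u < gs.length := fun u hu => by
      have := h.closed u v ⟨gs[v], by simp [listTable], hu⟩
      by_contra hc
      exact this (by simpa [listTable] using hc)
    generalize gs[v] = g at hlt
    cases g with
    | negOne => exact ⟨.negOne, rfl⟩
    | var i => exact ⟨.var i, rfl⟩
    | add u w => exact ⟨.add ⟨u, hlt u (.inl rfl)⟩ ⟨w, hlt w (.inr rfl)⟩, rfl⟩
    | mul u w => exact ⟨.mul ⟨u, hlt u (.inl rfl)⟩ ⟨w, hlt w (.inr rfl)⟩, rfl⟩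
  choose gate hgate using hex
  have hE : ∀ u v : Fin gs.length, (gate v).HasChild u ↔
      Edge (listTable gs) (u : ℕ) (v : ℕ) := by
    intro u v
    simp [Edge, listTable, ← Fin.getElem_fin, ← hgate, Gate.hasChild_map, Fin.val_inj]
  have ho : o < gs.length := by
    by_contra hc
    exact h.out_mem (by simpa [listTable] using hc)
  have hwf : WellFounded fun u v : Fin gs.length => (gate v).HasChild u := by
    simp only [hE]
    exact InvImage.wf Fin.val h.wf
  have hsink : ∀ v : Fin gs.length, (∀ w, ¬ (gate w).HasChild v) → v = ⟨o, ho⟩ := by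
    intro v hv
    refine Fin.ext (h.sink v (by simp [listTable]) fun w hw => ?_)
    have hw' : w < gs.length := by
      obtain ⟨g, hg, -⟩ := hw
      exact (List.getElem?_eq_some_iff.1 hg).1
    exact hv ⟨w, hw'⟩ ((hE _ _).2 hw)
  let C : ArithCircuit :=
    { size := gs.length
      gate := gate
      acyclic := hwf
      output := ⟨o, ho⟩
      isSink_iff := fun v => by
        refine ⟨hsink v, ?_⟩
        rintro rfl
        have : Nonempty (Fin gs.length) := ⟨⟨o, ho⟩⟩
        obtain ⟨v, hv⟩ := hwf.exists_sink
        rwa [hsink v hv] at hv }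
  refine ⟨C, ?_⟩
  rw [encode_eq]
  congr 1
  exact List.ext_getElem (by simp [gateList, C]) fun v h1 h2 => by
    simp [gateList, C, hgate]

end ArithCircuit

open GateTable

/-- The words of the circuits whose polynomial satisfies `p`. -/
def circuitLanguage (p : MvPolynomial ℕ ℤ → Prop) : Language CircuitSymbol :=
  {w | ∃ C : ArithCircuit, C.encode = w ∧ p C.poly}

/-! ### Membership of words in terms of gate tables. -/

section Language

variable {o o' : ℕ} {gs gs' : List (Gate ℕ)} {p q : MvPolynomial ℕ ℤ → Prop}

theorem GateTable.IsCircuit.of_mem (h : encodeGates o gs ∈ circuitLanguage p) :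
    IsCircuit (listTable gs) o := by
  obtain ⟨C, hC, -⟩ := h
  rw [C.encode_eq] at hC
  obtain ⟨rfl, rfl⟩ := encodeGates_inj hC
  exact C.isCircuit_gateList

theorem GateTable.IsCircuit.exists_isValuation (h : IsCircuit (listTable gs) o) :
    ∃ val, IsValuation (listTable gs) val := by
  obtain ⟨C, hC⟩ := h.exists_circuit
  rw [C.encode_eq] at hC
  obtain ⟨rfl, rfl⟩ := encodeGates_inj hC
  obtain ⟨val, hval, -⟩ := C.exists_isValuation
  exact ⟨val, hval⟩

/-- Since the encoding is injective, a circuit with this word has this very table, and uniqueness of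
valuations identifies its polynomial with `val o`. -/
theorem GateTable.IsCircuit.mem_iff (h : IsCircuit (listTable gs) o)
    {val : ℕ → MvPolynomial ℕ ℤ} (hval : IsValuation (listTable gs) val) :
    encodeGates o gs ∈ circuitLanguage p ↔ p (val o) := by
  have key : ∀ C : ArithCircuit, C.encode = encodeGates o gs → C.poly = val o := by
    intro C hC
    rw [C.encode_eq] at hC
    obtain ⟨rfl, rfl⟩ := encodeGates_inj hC
    obtain ⟨val', hval', h'⟩ := C.exists_isValuation
    rw [← h']
    exact hval'.unique h hval _ h.out_mem
  constructor
  · rintro ⟨C, hC, hp⟩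
    rwa [← key C hC]
  · intro hp
    obtain ⟨C, hC⟩ := h.exists_circuit
    exact ⟨C, hC, by rwa [key C hC]⟩

/-- Membership is preserved by a translation of circuits that preserves validity and translates
the computed polynomials. -/
theorem mem_circuitLanguage_iff_of_translation
    (hc : IsCircuit (listTable gs') o' ↔ IsCircuit (listTable gs) o)
    (hv : IsCircuit (listTable gs) o → ∀ val, IsValuation (listTable gs) val →
      ∃ val', IsValuation (listTable gs') val' ∧ (q (val' o') ↔ p (val o))) :
    encodeGates o gs ∈ circuitLanguage p ↔ encodeGates o' gs' ∈ circuitLanguage q := by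
  by_cases h : IsCircuit (listTable gs) o
  · obtain ⟨val, hval⟩ := h.exists_isValuation
    obtain ⟨val', hval', hpq⟩ := hv h val hval
    rw [h.mem_iff hval, (hc.2 h).mem_iff hval', hpq]
  · exact ⟨fun hm => absurd (.of_mem hm) h, fun hm => absurd (hc.1 (.of_mem hm)) h⟩

end Language

open GateTable MvPolynomial

/-! ## From identity testing to multilinearity -/

/-- Multiplication by `X i` twice shifts exponents without cancellation, so any monomial of `p`
survives with exponent at least two in `X i`. -/
theorem isMultilinearPoly_mul_X_sq_iff (p : MvPolynomial ℕ ℤ) (i : ℕ) :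
    IsMultilinearPoly (X i * X i * p) ↔ p = 0 := by
  constructor
  · intro h
    by_contra hp
    obtain ⟨m, hm⟩ := MvPolynomial.ne_zero_iff.1 hp
    have := h (Finsupp.single i 1 + (Finsupp.single i 1 + m)) (by
      rw [mem_support_iff, mul_assoc, coeff_X_mul, coeff_X_mul]
      exact hm) i
    simp at this
  · rintro rfl m hm
    simp at hm

/-- The gates of a circuit for `X₀² p`, where `p` is the polynomial of the circuit `gs` with
output `o`; its output is gate `2`. -/
def squareGates (o : ℕ) (gs : List (Gate ℕ)) : List (Gate ℕ) :=
  [.var 0, .mul 0 0, .mul 1 (3 + o)] ++ gs.map (Gate.map (3 + ·))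

/-- The gate table of `squareGates`, with the old gates on the right. -/
def squareTable (o : ℕ) (P : ℕ → Option (Gate ℕ)) : Fin 3 ⊕ ℕ → Option (Gate (Fin 3 ⊕ ℕ))
  | .inl 0 => some (.var 0)
  | .inl 1 => some (.mul (.inl 0) (.inl 0))
  | .inl 2 => some (.mul (.inl 1) (.inr o))
  | .inr v => (P v).map (Gate.map Sum.inr)

theorem listTable_squareGates (o : ℕ) (gs : List (Gate ℕ)) (a : Fin 3 ⊕ ℕ) :
    listTable (squareGates o gs) (finSumNatEquiv 3 a) =
      (squareTable o (listTable gs) a).map (Gate.map (finSumNatEquiv 3)) := by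
  rcases a with a | v
  · fin_cases a <;> rfl
  · simp only [squareTable, listTable, squareGates, finSumNatEquiv_apply_right, Option.map_map]
    rw [List.getElem?_append_right (by simp)]
    simp only [List.length_cons, List.length_nil, Nat.reduceAdd, add_tsub_cancel_left,
      List.getElem?_map]
    congr 1
    funext g
    cases g <;> rfl

section Square

variable {o : ℕ} {P : ℕ → Option (Gate ℕ)}

theorem edge_squareTable_inr (u v : ℕ) :
    Edge (squareTable o P) (.inr u) (.inr v) ↔ Edge P u v := by
  simp [Edge, squareTable, Gate.hasChild_map]

/-- The old gates keep their children and acquire no new ones, so cycles and missing children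
correspond. The only new parent of an old gate is gate `2` above `o`: any other sink remains a sink,
whereas `o` is none. -/
theorem isCircuit_squareTable : IsCircuit (squareTable o P) (.inl 2) ↔ IsCircuit P o := by
  have e20 : Edge (squareTable o P) (.inl 0) (.inl 1) := ⟨_, rfl, .inl rfl⟩
  have e21 : Edge (squareTable o P) (.inl 1) (.inl 2) := ⟨_, rfl, .inl rfl⟩
  have e2o : Edge (squareTable o P) (.inr o) (.inl 2) := ⟨_, rfl, .inr rfl⟩
  have hn : ∀ v, squareTable o P (.inr v) ≠ none ↔ P v ≠ none := fun v => by simp [squareTable]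
  constructor
  · rintro ⟨h1, h2, h3, h4⟩
    refine ⟨fun u v h => (hn u).1 (h1 _ _ ((edge_squareTable_inr u v).2 h)), ?_,
      fun v hv h => ?_, (hn o).1 (h1 _ _ e2o)⟩
    · have := InvImage.wf Sum.inr h2
      refine Subrelation.wf (fun {u v} h => ?_) this
      exact (edge_squareTable_inr u v).2 h
    · by_contra hvo
      refine absurd (h3 (.inr v) ((hn v).2 hv) ?_) (by simp)
      rintro (w | w) hw
      · obtain ⟨g, hg, hc⟩ := hw
        fin_cases w <;> simp [squareTable] at hg <;> subst hg <;> simp [Gate.HasChild] at hc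
        exact hvo hc
      · exact h w ((edge_squareTable_inr _ _).1 hw)
  · rintro ⟨h1, h2, h3, h4⟩
    have hr : ∀ v, Acc (Edge (squareTable o P)) (.inr v) := fun v => by
      induction v using h2.induction with
      | _ v ih =>
        refine ⟨_, ?_⟩
        rintro (u | u) hu
        · obtain ⟨g, hg, hc⟩ := hu
          obtain ⟨g, -, rfl⟩ := Option.map_eq_some_iff.1 hg
          simp [Gate.hasChild_map] at hc
        · exact ih u ((edge_squareTable_inr _ _).1 hu)
    have a0 : Acc (Edge (squareTable o P)) (.inl 0) := ⟨_, by
      rintro u ⟨g, hg, hc⟩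
      cases hg
      exact hc.elim⟩
    have a1 : Acc (Edge (squareTable o P)) (.inl 1) := ⟨_, by
      rintro u ⟨g, hg, hc⟩
      cases hg
      rcases hc with rfl | rfl <;> exact a0⟩
    have a2 : Acc (Edge (squareTable o P)) (.inl 2) := ⟨_, by
      rintro u ⟨g, hg, hc⟩
      cases hg
      rcases hc with rfl | rfl
      exacts [a1, hr o]⟩
    refine ⟨?_, ⟨?_⟩, ?_, by simp [squareTable]⟩
    · rintro (u | u) v h
      · fin_cases u <;> simp [squareTable]
      · rcases v with v | v
        · obtain ⟨g, hg, hc⟩ := h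
          fin_cases v <;> simp [squareTable] at hg <;> subst hg <;> simp [Gate.HasChild] at hc
          rw [hc]
          exact (hn o).2 h4
        · exact (hn u).2 (h1 u v ((edge_squareTable_inr u v).1 h))
    · rintro (v | v)
      · fin_cases v
        exacts [a0, a1, a2]
      · exact hr v
    · rintro (v | v) hv h
      · fin_cases v
        · exact absurd e20 (h _)
        · exact absurd e21 (h _)
        · rfl
      · rw [h3 v ((hn v).1 hv) fun w hw => h _ ((edge_squareTable_inr _ _).2 hw)] at h
        exact absurd e2o (h _)

theorem isValuation_squareTable {val : ℕ → MvPolynomial ℕ ℤ} (h : IsValuation P val) :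
    IsValuation (squareTable o P)
      (Sum.elim ![X 0, X 0 * X 0, X 0 * X 0 * val o] val) := by
  rintro (v | v) g hg
  · fin_cases v <;> simp [squareTable] at hg <;> subst hg <;> simp [Gate.eval]
  · obtain ⟨g, hg', rfl⟩ := Option.map_eq_some_iff.1 hg
    rw [Gate.eval_map]
    exact h v g hg'

end Square

theorem mem_ACIT_iff_squareGates (o : ℕ) (gs : List (Gate ℕ)) :
    encodeGates o gs ∈ ACIT ↔ encodeGates 2 (squareGates o gs) ∈ CheckML := by
  refine mem_circuitLanguage_iff_of_translation (p := (· = 0)) (q := IsMultilinearPoly) ?_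
    fun _ val hval => ⟨_, isValuation_transport _ (listTable_squareGates o gs) (isValuation_squareTable hval), ?_⟩
  · exact (isCircuit_transport (finSumNatEquiv 3) (listTable_squareGates o gs) (.inl 2)).trans
      isCircuit_squareTable
  · have : (finSumNatEquiv 3).symm 2 = .inl 2 := rfl
    rw [Function.comp_apply, this]
    exact isMultilinearPoly_mul_X_sq_iff _ _

/-! ## From multilinearity to identity testing -/

/-- The value that replaces `X i` in the copies of type `t`. -/
noncomputable def copyPoint (i : ℕ) : Fin 3 → MvPolynomial ℕ ℤ := ![X i, 0, -1]

/-- The substitution of the copies of type `t` for the variable `X i`. -/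
noncomputable def copySubst (i : ℕ) (t : Fin 3) : MvPolynomial ℕ ℤ →ₐ[ℤ] MvPolynomial ℕ ℤ :=
  aeval (Function.update X i (copyPoint i t))

/-- A polynomial that vanishes if and only if `p` has degree at most one in `X i`. -/
noncomputable def linearityDefect (i : ℕ) (p : MvPolynomial ℕ ℤ) : MvPolynomial ℕ ℤ :=
  (copySubst i 0 p + -1 * copySubst i 1 p) +
    X i * (copySubst i 2 p + -1 * copySubst i 1 p)

theorem copySubst_zero (i : ℕ) (p : MvPolynomial ℕ ℤ) : copySubst i 0 p = p := by
  simp [copySubst, copyPoint]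

theorem copySubst_X (i j : ℕ) (t : Fin 3) :
    copySubst i t (X j) = if j = i then copyPoint i t else X j := by
  by_cases h : j = i
  · subst h; simp [copySubst]
  · simp [copySubst, h]

theorem linearityDefect_add (i : ℕ) (p q : MvPolynomial ℕ ℤ) :
    linearityDefect i (p + q) = linearityDefect i p + linearityDefect i q := by
  simp only [linearityDefect, map_add]; ring

/-- After a constant has been substituted for `X i`, no monomial contains `X i`. -/
theorem coeff_copySubst_eq_zero (i : ℕ) {t : Fin 3} (ht : t ≠ 0) (p : MvPolynomial ℕ ℤ)
    {m : ℕ →₀ ℕ} (hm : m i ≠ 0) : (copySubst i t p).coeff m = 0 := by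
  by_contra h
  have h1 : i ∈ (copySubst i t p).vars :=
    (mem_vars_iff_mem_support i).2 ⟨m, mem_support_iff.2 h, Finsupp.mem_support_iff.2 hm⟩
  have h2 : ∀ j, i ∉ (Function.update X i (copyPoint i t) j : MvPolynomial ℕ ℤ).vars := by
    intro j
    by_cases hj : j = i
    · subst hj
      fin_cases t
      · exact absurd rfl ht
      · simp [copyPoint]
      · simp [copyPoint, vars_neg]
    · simp [hj, vars_X, Ne.symm hj]
  have h3 := vars_bind₁ (Function.update X i (copyPoint i t)) p h1
  simp only [Finset.mem_biUnion] at h3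
  obtain ⟨j, -, hj⟩ := h3
  exact h2 j hj

/-- Apart from `p` itself, every term has a constant in place of `X i` and at most one factor `X i`
in front. -/
theorem coeff_linearityDefect (i : ℕ) (p : MvPolynomial ℕ ℤ) {m : ℕ →₀ ℕ} (hm : 2 ≤ m i) :
    (linearityDefect i p).coeff m = p.coeff m := by
  -- One `X i` is split off for the factor in front of the second bracket; as `2 ≤ m i`, the rest
  -- `m'` still contains `X i`.
  obtain ⟨m', rfl⟩ : ∃ m', m = Finsupp.single i 1 + m' :=
    ⟨m - Finsupp.single i 1, by
      ext j
      by_cases hj : j = i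
      · subst hj; simp; omega
      · simp [Ne.symm hj]⟩
  have hm' : m' i ≠ 0 := by simp at hm; omega
  have h1 : ∀ q : MvPolynomial ℕ ℤ, -1 * q = -q := fun q => by ring
  rw [linearityDefect, coeff_add, coeff_X_mul, copySubst_zero, h1, coeff_add, coeff_add, coeff_neg,
    coeff_neg, coeff_copySubst_eq_zero i (by decide) p (by omega),
    coeff_copySubst_eq_zero i (by decide) p hm', coeff_copySubst_eq_zero i (by decide) p hm']
  simp

/-- With `e = m i` and the other variables factored out, what remains is `(X^e - 0^e) + X ((-1)^e -
0^e)`, which is zero for `e = 0` and for `e = 1`. -/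
theorem linearityDefect_monomial (i : ℕ) {m : ℕ →₀ ℕ} (c : ℤ) (hm : m i ≤ 1) :
    linearityDefect i (monomial m c) = 0 := by
  have key : ∀ t, copySubst i t (monomial m c) =
      copyPoint i t ^ m i * copySubst i 0 (monomial (m.erase i) c) := by
    intro t
    have h : monomial m c = X i ^ m i * monomial (m.erase i) c := by
      rw [X_pow_eq_monomial, monomial_mul, one_mul, Finsupp.single_add_erase]
    have h' : copySubst i t (monomial (m.erase i) c) = copySubst i 0 (monomial (m.erase i) c) := by
      simp only [copySubst, aeval_monomial]
      congr 1
      refine Finsupp.prod_congr fun j hj => ?_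
      have : j ≠ i := by rintro rfl; simp at hj
      simp [this]
    rw [h, map_mul, map_pow, h', copySubst_X, if_pos rfl]
  rw [linearityDefect, key 0, key 1, key 2]
  have : m i = 0 ∨ m i = 1 := by omega
  rcases this with h | h <;> rw [h] <;> simp [copyPoint]

theorem isMultilinearPoly_iff (p : MvPolynomial ℕ ℤ) :
    IsMultilinearPoly p ↔ ∀ i, linearityDefect i p = 0 := by
  constructor
  · intro h i
    have h0 : linearityDefect i 0 = 0 := by simp [linearityDefect]
    -- The defect is additive, so it can be evaluated monomial by monomial.
    have hsum : ∀ s : Finset (ℕ →₀ ℕ), (∀ m ∈ s, m i ≤ 1) →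
        linearityDefect i (∑ m ∈ s, monomial m (p.coeff m)) = 0 := by
      intro s
      induction s using Finset.induction_on with
      | empty => simp [h0]
      | insert a s ha ih =>
        intro hs
        rw [Finset.sum_insert ha, linearityDefect_add,
          linearityDefect_monomial i _ (hs a (by simp)),
          ih fun m hm => hs m (by simp [hm]), add_zero]
    have := hsum p.support fun m hm => h m hm i
    rwa [← p.as_sum] at this
  · intro h m hm i
    by_contra hc
    rw [mem_support_iff, ← coeff_linearityDefect i p (by omega), h i] at hm
    exact hm (coeff_zero m)

/-- At every integer point the sum becomes one of nonnegative integers, so each summand vanishes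
there; a polynomial over `ℤ` that vanishes at all integer points is zero. -/
theorem sum_sq_eq_zero_iff {ι : Type} (s : Finset ι) (f : ι → MvPolynomial ℕ ℤ) :
    ∑ i ∈ s, f i * f i = 0 ↔ ∀ i ∈ s, f i = 0 := by
  constructor
  · intro h i hi
    refine MvPolynomial.funext fun x => ?_
    have := congrArg (eval x) h
    simp only [map_sum, map_mul, map_zero] at this
    rw [Finset.sum_eq_zero_iff_of_nonneg fun j _ => mul_self_nonneg _] at this
    simpa using this i hi
  · intro h
    exact Finset.sum_eq_zero fun i hi => by simp [h i hi]

/-- The constants `-1`, `1` and `0`. -/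
def constGate {W : Type} (c₀ c₁ : W) : Fin 3 → Gate W :=
  ![.negOne, .mul c₀ c₀, .add c₀ c₁]

/-- The gates that compute the squared linearity defect for `X i` from the outputs `F` of the three
copies of the circuit, and add it to `acc`. -/
def headerGate {W : Type} (F : Fin 3 → W) (h : Fin 8 → W) (c₀ acc : W) (i : ℕ) : Fin 8 → Gate W :=
  ![.var i, .mul c₀ (F 1), .add (F 0) (h 1), .add (F 2) (h 1), .mul (h 0) (h 3),
    .add (h 2) (h 4), .mul (h 5) (h 5), .add (h 6) acc]

/-- The copy of type `t` for the variable `X i` of a gate. -/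
def copyGate {W : Type} (ref : ℕ → W) (c₀ c₁ : W) (i : ℕ) (t : Fin 3) : Gate ℕ → Gate W
  | .negOne => .negOne
  | .var a => if a = i then ![.var a, .add c₀ c₁, .negOne] t else .var a
  | .add u w => .add (ref u) (ref w)
  | .mul u w => .mul (ref u) (ref w)

/-- The name of a copy of the gate `v`. -/
def copyName (M v i t : ℕ) : ℕ := 3 + 8 * M + ((v * M + i) * 3 + t)

/-- The gates of a circuit for the sum of the squares of the linearity defects for the variables
`X i`, `i < M`; its output is gate `2 + 8 * M`. -/
def defectGates (M o : ℕ) (gs : List (Gate ℕ)) : List (Gate ℕ) :=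
  List.ofFn (constGate 0 1) ++
    ((List.range M).flatMap (fun i => List.ofFn
      (headerGate (fun t => copyName M o i t) (fun d => 3 + 8 * i + d) 0 (2 + 8 * i) i)) ++
    gs.flatMap fun g => (List.range M).flatMap fun i => List.ofFn fun t : Fin 3 =>
      copyGate (fun u => copyName M u i t) 0 1 i t g)

/-- The structured names of the gates of `defectGates`. -/
inductive DefectAddr (M : ℕ) : Type
  | const (d : Fin 3)
  | header (i : Fin M) (d : Fin 8)
  | copy (v : ℕ) (i : Fin M) (t : Fin 3)

namespace DefectAddr

variable {M : ℕ}

/-- The number of a gate. -/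
def name : DefectAddr M → ℕ
  | const d => d
  | header i d => 3 + 8 * i + d
  | copy v i t => copyName M v i t

/-- The gate that holds the sum of the first `j` squares. -/
def acc : ∀ j, j ≤ M → DefectAddr M
  | 0, _ => const 2
  | j + 1, h => header ⟨j, h⟩ 7

theorem name_acc (j : ℕ) (h : j ≤ M) : (acc j h).name = 2 + 8 * j := by
  cases j with
  | zero => rfl
  | succ j => simp [acc, name]; omega

/-- The names form three consecutive blocks: constants, headers, and copies. In the last block `v`,
`i`, `t` are the digits in a mixed radix, with `M` values for `i` and `3` for `t`. -/
theorem name_bijective (hM : 0 < M) : Function.Bijective (name (M := M)) := by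
  constructor
  · rintro (d | ⟨i, d⟩ | ⟨v, i, t⟩) (d' | ⟨i', d'⟩ | ⟨v', i', t'⟩) h <;>
      simp only [name, copyName] at h
    · rw [Fin.ext h]
    · omega
    · omega
    · omega
    · have h1 : (i : ℕ) = i' := by omega
      have h2 : (d : ℕ) = d' := by omega
      rw [Fin.ext h1, Fin.ext h2]
    · omega
    · omega
    · omega
    · have h1 : (t : ℕ) = t' := by omega
      have h2 : (i : ℕ) + M * v = i' + M * v' := by rw [mul_comm M, mul_comm M]; omega
      have h3 : (i : ℕ) = i' := by
        have := congrArg (· % M) h2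
        simpa [Nat.add_mul_mod_self_left, Nat.mod_eq_of_lt] using this
      have h4 : v = v' := Nat.eq_of_mul_eq_mul_left hM (by omega)
      rw [Fin.ext h1, Fin.ext h3, h4]
  · intro k
    by_cases h1 : k < 3
    · exact ⟨const ⟨k, h1⟩, rfl⟩
    by_cases h2 : k < 3 + 8 * M
    · exact ⟨header ⟨(k - 3) / 8, by omega⟩ ⟨(k - 3) % 8, by omega⟩, by simp [name]; omega⟩
    · refine ⟨copy ((k - (3 + 8 * M)) / 3 / M) ⟨(k - (3 + 8 * M)) / 3 % M, Nat.mod_lt _ hM⟩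
        ⟨(k - (3 + 8 * M)) % 3, by omega⟩, ?_⟩
      simp only [name, copyName]
      have := Nat.div_add_mod' ((k - (3 + 8 * M)) / 3) M
      omega

/-- The numbering of the gates. -/
noncomputable def nameEquiv (hM : 0 < M) : DefectAddr M ≃ ℕ :=
  Equiv.ofBijective name (name_bijective hM)

/-- The gate table of `defectGates`. -/
def table (M o : ℕ) (P : ℕ → Option (Gate ℕ)) : DefectAddr M → Option (Gate (DefectAddr M))
  | const d => some (constGate (const 0) (const 1) d)
  | header i d => some (headerGate (copy o i) (header i) (const 0) (acc i i.is_lt.le) i d)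
  | copy v i t => (P v).map (copyGate (copy · i t) (const 0) (const 1) i t)

end DefectAddr

theorem List.getElem?_flatMap_of_length {γ δ : Type} {l : List γ} {f : γ → List δ} {n : ℕ}
    (hf : ∀ a, (f a).length = n) (i : ℕ) {j : ℕ} (hj : j < n) :
    (l.flatMap f)[i * n + j]? = l[i]?.bind fun a => (f a)[j]? := by
  induction l generalizing i with
  | nil => simp
  | cons a l ih =>
    rw [List.flatMap_cons]
    cases i with
    | zero => simp [List.getElem?_append_left (show j < (f a).length by rw [hf]; exact hj)]
    | succ i =>
      rw [List.getElem?_append_right (by rw [hf]; nlinarith), hf,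
        show (i + 1) * n + j - n = i * n + j by rw [Nat.succ_mul]; omega, ih]
      simp

namespace DefectAddr

variable {M o : ℕ}

/-- Copies are ordered by gate, then variable, then type, so that a machine can write them in a
single pass over the gates. Within their block the position is `v * 3M + 3i + t`. -/
theorem listTable_defectGates (gs : List (Gate ℕ)) (a : DefectAddr M) :
    listTable (defectGates M o gs) a.name = (table M o (listTable gs) a).map (Gate.map name) := by
  have hlen : ((List.range M).flatMap (fun i => List.ofFn
      (headerGate (fun t => copyName M o i t) (fun d => 3 + 8 * i + d) 0 (2 + 8 * i) i))).length =
      8 * M := by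
    simp [List.length_flatMap, mul_comm]
  rcases a with d | ⟨i, d⟩ | ⟨v, i, t⟩
  · simp only [listTable, defectGates, name, table]
    rw [List.getElem?_append_left (by simp)]
    fin_cases d <;> rfl
  · simp only [listTable, defectGates, name, table]
    rw [List.getElem?_append_right (by simp; omega), List.length_ofFn,
      List.getElem?_append_left (by rw [hlen]; omega),
      show 3 + 8 * (i : ℕ) + d - 3 = i * 8 + d by omega,
      List.getElem?_flatMap_of_length (by simp) _ d.is_lt, List.getElem?_range i.is_lt]
    simp only [Option.bind_some, Option.map_some]
    rw [List.getElem?_ofFn, dif_pos d.is_lt]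
    have := name_acc (i : ℕ) i.is_lt.le
    congr 1
    fin_cases d
    -- Only gate `7` of a header refers to the accumulator, whose name is supplied by `name_acc`.
    pick_goal 8
    · simp only [headerGate, Gate.map, name]
      exact congrArg (Gate.add _) this.symm
    all_goals simp [headerGate, Gate.map, name]
  · simp only [listTable, defectGates, name, table]
    have hle : 3 + 8 * M ≤ copyName M v i t := Nat.le_add_right _ _
    rw [List.getElem?_append_right (by simp; omega), List.length_ofFn,
      List.getElem?_append_right (by rw [hlen]; omega), hlen, copyName,
      show 3 + 8 * M + ((v * M + i) * 3 + t) - 3 - 8 * M = v * (M * 3) + (i * 3 + t) by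
        rw [add_mul, mul_assoc]; omega,
      List.getElem?_flatMap_of_length (n := M * 3) (by simp [List.length_flatMap]) _
        (show (i : ℕ) * 3 + t < M * 3 by omega)]
    cases gs[v]? with
    | none => rfl
    | some g =>
      simp only [Option.bind_some, Option.map_some]
      rw [List.getElem?_flatMap_of_length (by simp) _ t.is_lt, List.getElem?_range i.is_lt]
      simp only [Option.bind_some]
      rw [List.getElem?_ofFn, dif_pos t.is_lt]
      congr 1
      cases g with
      | negOne => rfl
      | add u w => rfl
      | mul u w => rfl
      | var a =>
        by_cases h : a = i
        · fin_cases t <;> simp [copyGate, h, Gate.map, name]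
        · simp [copyGate, h, Gate.map]

/-! ### Validity of the defect circuit. -/

variable {P : ℕ → Option (Gate ℕ)}

/-- Copies for different `i` or `t` are not linked. The only children a copy has outside itself are
the constants used to express zero in place of a variable. -/
theorem hasChild_copyGate {u : ℕ} {i i' : Fin M} {t t' : Fin 3} {g : Gate ℕ} :
    (copyGate (copy (M := M) · i t) (const 0) (const 1) i t g).HasChild (copy u i' t') ↔
      g.HasChild u ∧ i' = i ∧ t' = t := by
  cases g with
  | negOne => simp [copyGate, Gate.HasChild]
  | add u w => simp [copyGate, Gate.HasChild, or_and_right]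
  | mul u w => simp [copyGate, Gate.HasChild, or_and_right]
  | var a =>
    by_cases h : a = i
    · fin_cases t <;> simp [copyGate, h, Gate.HasChild]
    · simp [copyGate, h, Gate.HasChild]

theorem not_hasChild_copyGate_header {i i' : Fin M} {d : Fin 8} {t : Fin 3} {g : Gate ℕ} :
    ¬ (copyGate (copy (M := M) · i t) (const 0) (const 1) i t g).HasChild (header i' d) := by
  cases g with
  | negOne => simp [copyGate, Gate.HasChild]
  | add u w => simp [copyGate, Gate.HasChild]
  | mul u w => simp [copyGate, Gate.HasChild]
  | var a =>
    by_cases h : a = i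
    · fin_cases t <;> simp [copyGate, h, Gate.HasChild]
    · simp [copyGate, h, Gate.HasChild]

theorem edge_copy {u v : ℕ} {i i' : Fin M} {t t' : Fin 3} :
    Edge (table M o P) (copy u i' t') (copy v i t) ↔ Edge P u v ∧ i' = i ∧ t' = t := by
  constructor
  · rintro ⟨g, hg, hc⟩
    obtain ⟨g, hg', rfl⟩ := Option.map_eq_some_iff.1 hg
    obtain ⟨h1, h2⟩ := hasChild_copyGate.1 hc
    exact ⟨⟨g, hg', h1⟩, h2⟩
  · rintro ⟨⟨g, hg, hc⟩, h⟩
    exact ⟨_, by rw [table, hg]; rfl, hasChild_copyGate.2 ⟨hc, h⟩⟩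

theorem acc_ne_copy {j : ℕ} {h : j ≤ M} {v : ℕ} {i : Fin M} {t : Fin 3} :
    acc j h ≠ copy v i t := by
  cases j <;> simp [acc]

theorem eq_of_edge_header {v : ℕ} {i i' : Fin M} {t : Fin 3} {d : Fin 8}
    (h : Edge (table M o P) (copy v i t) (header i' d)) : v = o := by
  obtain ⟨g, hg, hc⟩ := h
  rw [table, Option.some_inj] at hg
  subst hg
  have := fun j h => (acc_ne_copy (M := M) (j := j) (h := h) (v := v) (i := i) (t := t)).symm
  fin_cases d <;> simp [headerGate, Gate.HasChild, this] at hc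
  all_goals exact hc.1

theorem not_edge_const {v : ℕ} {i : Fin M} {t d : Fin 3} :
    ¬ Edge (table M o P) (copy v i t) (const d) := by
  rintro ⟨g, hg, hc⟩
  rw [table, Option.some_inj] at hg
  subst hg
  fin_cases d <;> simp [constGate, Gate.HasChild] at hc

/-- A single copy, available because `0 < M`, reflects closedness and acyclicity. A sink `v ≠ o`
would have a copy that is a sink, but the output is an accumulator; and `o` is present because a
header gate has a copy of it as a child. -/
theorem isCircuit_of_table (hM : 0 < M) (h : IsCircuit (table M o P) (acc M le_rfl)) :
    IsCircuit P o := by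
  obtain ⟨h1, h2, h3, h4⟩ := h
  have hn : ∀ v i t, table M o P (copy v i t) ≠ none ↔ P v ≠ none := fun v i t => by simp [table]
  refine ⟨fun u v h => (hn u ⟨0, hM⟩ 0).1 (h1 _ _ (edge_copy.2 ⟨h, rfl, rfl⟩)), ?_,
    fun v hv h => ?_, ?_⟩
  · refine Subrelation.wf (fun {u v} h => ?_) (InvImage.wf (copy · ⟨0, hM⟩ 0) h2)
    exact edge_copy.2 ⟨h, rfl, rfl⟩
  · by_contra hvo
    refine acc_ne_copy (h3 (copy v ⟨0, hM⟩ 0) ((hn _ _ _).2 hv) ?_).symm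
    rintro (d | ⟨i, d⟩ | ⟨w, i, t⟩) hw
    · exact not_edge_const hw
    · exact hvo (eq_of_edge_header hw)
    · exact h w (edge_copy.1 hw).1
  · exact (hn o ⟨0, hM⟩ 1).1 (h1 _ (header ⟨0, hM⟩ 1) ⟨_, rfl, .inr rfl⟩)

theorem acc_of_hasChild {V : Type} {Q : V → Option (Gate V)} {v : V} {g : Gate V}
    (hg : Q v = some g) (h : ∀ u, g.HasChild u → Acc (Edge Q) u) : Acc (Edge Q) v := by
  refine ⟨_, fun u hu => ?_⟩
  obtain ⟨g', hg', hu⟩ := hu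
  rw [hg, Option.some_inj] at hg'
  exact h u (hg' ▸ hu)

theorem acc_of_hasChild₂ {V : Type} {Q : V → Option (Gate V)} {v a b : V}
    (hg : Q v = some (.add a b) ∨ Q v = some (.mul a b)) (ha : Acc (Edge Q) a)
    (hb : Acc (Edge Q) b) : Acc (Edge Q) v := by
  rcases hg with hg | hg <;>
  · refine acc_of_hasChild hg ?_
    rintro u (rfl | rfl) <;> assumption

/-- Constants lie below copies and copies below headers. A header depends on earlier headers only
through its accumulator, so accessibility climbs along the accumulators. -/
theorem wellFounded_table (h : WellFounded (Edge P)) : WellFounded (Edge (table M o P)) := by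
  have c0 : Acc (Edge (table M o P)) (const 0) :=
    acc_of_hasChild (g := .negOne) rfl fun u hu => hu.elim
  have c1 : Acc (Edge (table M o P)) (const 1) := acc_of_hasChild₂ (.inr rfl) c0 c0
  have c2 : Acc (Edge (table M o P)) (const 2) := acc_of_hasChild₂ (.inl rfl) c0 c1
  have hc : ∀ d, Acc (Edge (table M o P)) (const d) := by
    intro d; fin_cases d <;> assumption
  have hcopy : ∀ v i t, Acc (Edge (table M o P)) (copy v i t) := fun v i t => by
    induction v using h.induction with
    | _ v ih =>
      refine ⟨_, ?_⟩
      rintro (d | ⟨i', d⟩ | ⟨u, i', t'⟩) hu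
      · exact hc d
      · obtain ⟨g, hg, hx⟩ := hu
        obtain ⟨g, -, rfl⟩ := Option.map_eq_some_iff.1 hg
        exact absurd hx not_hasChild_copyGate_header
      · obtain ⟨h1, rfl, rfl⟩ := edge_copy.1 hu
        exact ih u h1
  have hstep : ∀ i : Fin M, Acc (Edge (table M o P)) (acc i i.is_lt.le) →
      ∀ d, Acc (Edge (table M o P)) (header i d) := by
    intro i hi
    have h0 : Acc (Edge (table M o P)) (header i 0) :=
      acc_of_hasChild (g := .var i) rfl fun u hu => hu.elim
    have h1 : Acc (Edge (table M o P)) (header i 1) := acc_of_hasChild₂ (.inr rfl) c0 (hcopy o i 1)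
    have h2 : Acc (Edge (table M o P)) (header i 2) := acc_of_hasChild₂ (.inl rfl) (hcopy o i 0) h1
    have h3 : Acc (Edge (table M o P)) (header i 3) := acc_of_hasChild₂ (.inl rfl) (hcopy o i 2) h1
    have h4 : Acc (Edge (table M o P)) (header i 4) := acc_of_hasChild₂ (.inr rfl) h0 h3
    have h5 : Acc (Edge (table M o P)) (header i 5) := acc_of_hasChild₂ (.inl rfl) h2 h4
    have h6 : Acc (Edge (table M o P)) (header i 6) := acc_of_hasChild₂ (.inr rfl) h5 h5
    have h7 : Acc (Edge (table M o P)) (header i 7) := acc_of_hasChild₂ (.inl rfl) h6 hi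
    intro d
    fin_cases d <;> assumption
  have hacc : ∀ j hj, Acc (Edge (table M o P)) (acc j hj) := by
    intro j
    induction j with
    | zero => exact fun _ => c2
    | succ j ih => exact fun hj => hstep ⟨j, hj⟩ (ih _) 7
  refine ⟨?_⟩
  rintro (d | ⟨i, d⟩ | ⟨v, i, t⟩)
  exacts [hc d, hstep i (hacc _ _) d, hcopy v i t]

/-- The gates are arranged so that each constant, each header gate and all three copies of `o` are
used, except for the last accumulator. Constant `2` is used as the initial accumulator, which
requires `0 < M`. -/
theorem isCircuit_table (hM : 0 < M) :
    IsCircuit (table M o P) (acc M le_rfl) ↔ IsCircuit P o := by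
  refine ⟨isCircuit_of_table hM, ?_⟩
  rintro ⟨h1, h2, h3, h4⟩
  have hn : ∀ v i t, table M o P (copy v i t) ≠ none ↔ P v ≠ none := fun v i t => by simp [table]
  have hacc : ∀ j (hj : j < M), ¬ ∀ w, ¬ Edge (table M o P) (acc j hj.le) w :=
    fun j hj h => h (header ⟨j, hj⟩ 7) ⟨_, rfl, .inr rfl⟩
  have ho : ∀ i t, ¬ ∀ w, ¬ Edge (table M o P) (copy o i t) w := by
    intro i t h
    fin_cases t
    · exact h (header i 2) ⟨_, rfl, .inl rfl⟩
    · exact h (header i 1) ⟨_, rfl, .inr rfl⟩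
    · exact h (header i 3) ⟨_, rfl, .inl rfl⟩
  refine ⟨?_, wellFounded_table h2, ?_, by cases M <;> simp [acc, table]⟩
  · rintro (d | ⟨i, d⟩ | ⟨u, i, t⟩) w h
    · simp [table]
    · simp [table]
    · rw [hn]
      rcases w with d | ⟨i', d⟩ | ⟨w, i', t'⟩
      · exact absurd h not_edge_const
      · rwa [eq_of_edge_header h]
      · exact h1 u w (edge_copy.1 h).1
  · rintro (d | ⟨i, d⟩ | ⟨v, i, t⟩) hv h
    · exfalso
      fin_cases d
      · exact h (const 1) ⟨_, rfl, .inl rfl⟩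
      · exact h (const 2) ⟨_, rfl, .inr rfl⟩
      · exact hacc 0 hM h
    · fin_cases d
      · exact absurd ⟨_, rfl, .inl rfl⟩ (h (header i 4))
      · exact absurd ⟨_, rfl, .inr rfl⟩ (h (header i 2))
      · exact absurd ⟨_, rfl, .inl rfl⟩ (h (header i 5))
      · exact absurd ⟨_, rfl, .inr rfl⟩ (h (header i 4))
      · exact absurd ⟨_, rfl, .inr rfl⟩ (h (header i 5))
      · exact absurd ⟨_, rfl, .inl rfl⟩ (h (header i 6))
      · exact absurd ⟨_, rfl, .inl rfl⟩ (h (header i 7))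
      -- Gate `7` is used by the next header if there is one; otherwise it is the output.
      · rcases Nat.lt_or_ge (i + 1) M with hi | hi
        · exact absurd h (hacc (i + 1) hi)
        · obtain ⟨i, hlt⟩ := i
          obtain rfl : M = i + 1 := by simp only at hi; omega
          rfl
    · exfalso
      rw [h3 v ((hn v i t).1 hv) fun w hw => h _ (edge_copy.2 ⟨hw, rfl, rfl⟩)] at h
      exact ho i t h

/-! ### Polynomials computed by the defect circuit. -/

/-- The polynomials of the gates of `defectGates`. -/
noncomputable def value (M o : ℕ) (val : ℕ → MvPolynomial ℕ ℤ) :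
    DefectAddr M → MvPolynomial ℕ ℤ
  | const d => (![-1, 1, 0] : Fin 3 → MvPolynomial ℕ ℤ) d
  | header i d =>
    (![X (i : ℕ), -1 * copySubst i 1 (val o), copySubst i 0 (val o) + -1 * copySubst i 1 (val o),
      copySubst i 2 (val o) + -1 * copySubst i 1 (val o),
      X (i : ℕ) * (copySubst i 2 (val o) + -1 * copySubst i 1 (val o)),
      linearityDefect i (val o), linearityDefect i (val o) * linearityDefect i (val o),
      ∑ j ∈ Finset.range (i + 1), linearityDefect j (val o) * linearityDefect j (val o)] :
      Fin 8 → MvPolynomial ℕ ℤ) d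
  | copy v i t => copySubst i t (val v)

theorem value_acc (val : ℕ → MvPolynomial ℕ ℤ) (j : ℕ) (hj : j ≤ M) :
    value M o val (acc j hj) =
      ∑ j ∈ Finset.range j, linearityDefect j (val o) * linearityDefect j (val o) := by
  cases j <;> simp [acc, value]

theorem isValuation_table {val : ℕ → MvPolynomial ℕ ℤ} (h : IsValuation P val) :
    IsValuation (table M o P) (value M o val) := by
  rintro (d | ⟨i, d⟩ | ⟨v, i, t⟩) g hg
  · rw [table, Option.some_inj] at hg
    subst hg
    fin_cases d <;> simp [constGate, Gate.eval, value]
  · rw [table, Option.some_inj] at hg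
    subst hg
    fin_cases d <;> simp [headerGate, Gate.eval, value_acc]
    pick_goal 8
    · simp [value, Finset.sum_range_succ, add_comm]
    all_goals simp [value, linearityDefect]
  · obtain ⟨g, hg', rfl⟩ := Option.map_eq_some_iff.1 hg
    simp only [value]
    rw [h v g hg']
    cases g with
    | negOne => simp [copyGate, Gate.eval]
    | add u w => simp [copyGate, Gate.eval, value]
    | mul u w => simp [copyGate, Gate.eval, value]
    | var a =>
      simp only [Gate.eval, copySubst_X, copyGate]
      by_cases ha : a = i
      · fin_cases t <;> simp [ha, copyPoint, value]
      · simp [ha]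

end DefectAddr

/-- Substitution for a variable that labels no gate turns a valuation into a valuation, so by
uniqueness all three substituted polynomials equal `val o`. -/
theorem linearityDefect_eq_zero_of_isValuation {P : ℕ → Option (Gate ℕ)} {o : ℕ}
    (hP : IsCircuit P o) {val : ℕ → MvPolynomial ℕ ℤ} (h : IsValuation P val) {i : ℕ}
    (hi : ∀ v, P v ≠ some (.var i)) : linearityDefect i (val o) = 0 := by
  have key : ∀ t, copySubst i t (val o) = val o := by
    intro t
    refine IsValuation.unique (val := fun v => copySubst i t (val v)) hP ?_ h o hP.out_mem
    intro v g hg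
    simp only
    rw [h v g hg]
    cases g with
    | negOne => simp [Gate.eval]
    | add u w => simp [Gate.eval]
    | mul u w => simp [Gate.eval]
    | var a =>
      have : a ≠ i := by rintro rfl; exact hi v hg
      simp [Gate.eval, copySubst_X, this]
  simp [linearityDefect, key]

/-- Multilinearity concerns all variables but the sum only those below `M`; the others label no
gate, so their defects vanish. -/
theorem mem_CheckML_iff_defectGates {M o : ℕ} {gs : List (Gate ℕ)} (hM : 0 < M)
    (hgs : ∀ a, Gate.var a ∈ gs → a < M) :
    encodeGates o gs ∈ CheckML ↔ encodeGates (2 + 8 * M) (defectGates M o gs) ∈ ACIT := by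
  have hname : DefectAddr.nameEquiv hM (DefectAddr.acc M le_rfl) = 2 + 8 * M :=
    DefectAddr.name_acc M le_rfl
  have ht : ∀ a, listTable (defectGates M o gs) (DefectAddr.nameEquiv hM a) =
      (DefectAddr.table M o (listTable gs) a).map (Gate.map (DefectAddr.nameEquiv hM)) :=
    DefectAddr.listTable_defectGates gs
  refine mem_circuitLanguage_iff_of_translation (p := IsMultilinearPoly) (q := (· = 0)) ?_
    fun hc val hval => ⟨_, isValuation_transport _ ht (DefectAddr.isValuation_table hval), ?_⟩
  · rw [← hname]
    exact (isCircuit_transport _ ht _).trans (DefectAddr.isCircuit_table hM)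
  · rw [← hname, Function.comp_apply, Equiv.symm_apply_apply, DefectAddr.value_acc,
      sum_sq_eq_zero_iff, isMultilinearPoly_iff]
    refine ⟨fun h i => ?_, fun h i _ => h i⟩
    by_cases hi : i < M
    · exact h i (Finset.mem_range.2 hi)
    · refine linearityDefect_eq_zero_of_isValuation hc hval fun v hv => hi (hgs i ?_)
      exact List.mem_of_getElem? hv

/-! ## Programs -/

namespace Block

open SpaceTransducer (inputCell)

section Basic

variable {k : ℕ} {α β : Type} {w : List α} {bd : ℕ}

/-- `Represents` carries the bound on the input head, which is needed wherever the `min` in `act`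
has to be resolved. -/
theorem Exec.of_pos_le {B : Block k α β} {s s' : CtrState k β} {b : Bool}
    (h : s.pos ≤ w.length + 1 → B.Exec w bd s b s') : B.Exec w bd s b s' :=
  fun m hm => h (hm.2.1 ▸ hm.1) m hm

/-- Leave through exit `b`. -/
def ret (b : Bool) : Block k α β := basic (fun _ => b) .stay none

/-- Emit the letter `x`. -/
def emit (x : β) : Block k α β := basic (fun _ => true) .stay (some x)

/-- Test the scanned cell. -/
def test (f : InputCell α → Bool) : Block k α β := basic f .stay none

/-- Move the input head to the left. -/
def moveLeft : Block k α β := basic (fun _ => true) .left none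

/-- Move the input head to the right. -/
def moveRight : Block k α β := basic (fun _ => true) .right none

/-- Emit a word. -/
def emits : List β → Block k α β
  | [] => ret true
  | x :: l => seq (emit x) (emits l)

/-- Leave through `true` if counter `i` is not zero, and through `false` otherwise. -/
def nonzero (i : Fin k) : Block k α β := cond (decNZ i) (inc i) (ret false)

/-- Run `B` as often as the value of the counter `x` says, with the number of finished rounds in
the counter `s`. -/
def forLoop (x s : Fin k) (B : Block k α β) : Block k α β :=
  seq (whileDo (nonzero x) (seq B (seq (decNZ x) (inc s)))) (whileDo (decNZ s) (inc x))

variable {p : ℕ} {c : Fin k → ℕ} {o : List β}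

theorem exec_ret (b : Bool) : (ret b : Block k α β).Exec w bd ⟨p, c, o⟩ b ⟨p, c, o⟩ := by
  refine .of_pos_le fun h => ?_
  simpa [ret, HeadMove.apply, min_eq_left h] using
    exec_basic (w := w) (bd := bd) (s := ⟨p, c, o⟩) (fun _ => b) .stay none

theorem exec_test (f : InputCell α → Bool) :
    (test f : Block k α β).Exec w bd ⟨p, c, o⟩ (f (inputCell w p)) ⟨p, c, o⟩ := by
  refine .of_pos_le fun h => ?_
  simpa [test, HeadMove.apply, min_eq_left h] using
    exec_basic (w := w) (bd := bd) (s := ⟨p, c, o⟩) f .stay none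

theorem exec_moveLeft : (moveLeft : Block k α β).Exec w bd ⟨p, c, o⟩ true ⟨p - 1, c, o⟩ :=
  .of_pos_le fun h => by
    have h' : p - 1 ≤ w.length + 1 := by simp only at h; omega
    simpa [moveLeft, HeadMove.apply, h'] using
      exec_basic (w := w) (bd := bd) (s := ⟨p, c, o⟩) (fun _ => true) .left none

theorem exec_moveRight (h : p ≤ w.length) :
    (moveRight : Block k α β).Exec w bd ⟨p, c, o⟩ true ⟨p + 1, c, o⟩ := by
  simpa [moveRight, HeadMove.apply, h] using
    exec_basic (w := w) (bd := bd) (s := ⟨p, c, o⟩) (fun _ => true) .right none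

theorem exec_nonzero (i : Fin k) (h : c i ≤ bd) :
    (nonzero i : Block k α β).Exec w bd ⟨p, c, o⟩ (decide (c i ≠ 0)) ⟨p, c, o⟩ := by
  have hd := exec_decNZ (α := α) (w := w) (bd := bd) (s := ⟨p, c, o⟩) i
  by_cases h0 : c i = 0
  · simp only [h0] at hd ⊢
    have h1 : Function.update c i (0 - 1) = c := by
      rw [Function.update_eq_self_iff, h0]
    rw [h1] at hd
    exact hd.cond_false (exec_ret false)
  · simp only [ne_eq, h0, not_false_eq_true, decide_true] at hd ⊢
    refine hd.cond_true ?_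
    have := exec_inc (α := α) (w := w) (bd := bd)
      (s := ⟨p, Function.update c i (c i - 1), o⟩) i (by simp; omega)
    have h1 : c i - 1 + 1 = c i := by omega
    simpa [h1] using this

/-- The fragment appends `l` to the output, moves the input head from `p` to `q`, and preserves the
counters. -/
def Emits (B : Block k α β) (w : List α) (bd : ℕ) (c : Fin k → ℕ) (p q : ℕ) (l : List β) : Prop :=
  ∀ o, B.Exec w bd ⟨p, c, o⟩ true ⟨q, c, o ++ l⟩

variable {q r : ℕ} {l l' : List β} {A B : Block k α β}

theorem Emits.seq (hA : A.Emits w bd c p q l) (hB : B.Emits w bd c q r l') :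
    (seq A B).Emits w bd c p r (l ++ l') := fun o => by
  simpa using Exec.seq (hA o) (hB (o ++ l))

theorem emits_ret : (ret true : Block k α β).Emits w bd c p p [] := fun o => by
  simpa using exec_ret true

theorem emits_emit (x : β) : (emit x : Block k α β).Emits w bd c p p [x] := by
  refine fun o => .of_pos_le fun h => ?_
  simpa [emit, HeadMove.apply, min_eq_left h] using
    exec_basic (w := w) (bd := bd) (s := ⟨p, c, o⟩) (fun _ => true) .stay (some x)

theorem emits_moveLeft : (moveLeft : Block k α β).Emits w bd c p (p - 1) [] := fun o => by
  simpa using exec_moveLeft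

theorem emits_moveRight (h : p ≤ w.length) :
    (moveRight : Block k α β).Emits w bd c p (p + 1) [] := fun o => by
  simpa using exec_moveRight h

theorem emits_emits (l : List β) : (emits l : Block k α β).Emits w bd c p p l := by
  induction l with
  | nil => exact emits_ret
  | cons x l ih => exact (emits_emit x).seq ih

theorem Emits.cond_test_true {f : InputCell α → Bool} (hf : f (inputCell w p) = true)
    (hA : A.Emits w bd c p q l) : (cond (test f) A B).Emits w bd c p q l := fun o => by
  have := exec_test (β := β) (w := w) (bd := bd) (p := p) (c := c) (o := o) f
  rw [hf] at this
  exact this.cond_true (hA o)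

theorem Emits.cond_test_false {f : InputCell α → Bool} (hf : f (inputCell w p) = false)
    (hB : B.Emits w bd c p q l) : (cond (test f) A B).Emits w bd c p q l := fun o => by
  have := exec_test (β := β) (w := w) (bd := bd) (p := p) (c := c) (o := o) f
  rw [hf] at this
  exact this.cond_false (hB o)

theorem Emits.while_test_false {f : InputCell α → Bool} (hf : f (inputCell w p) = false) :
    (whileDo (test f) A).Emits w bd c p p [] := fun o => by
  have := exec_test (β := β) (w := w) (bd := bd) (p := p) (c := c) (o := o) f
  rw [hf] at this
  simpa using this.whileDo_false

theorem Emits.while_test_true {f : InputCell α → Bool} (hf : f (inputCell w p) = true)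
    (hA : A.Emits w bd c p q l) (hr : (whileDo (test f) A).Emits w bd c q r l') :
    (whileDo (test f) A).Emits w bd c p r (l ++ l') := fun o => by
  have := exec_test (β := β) (w := w) (bd := bd) (p := p) (c := c) (o := o) f
  rw [hf] at this
  simpa using this.whileDo_true (hA o) (hr (o ++ l))

/-- Moving the contents of counter `s` to counter `x`. -/
theorem exec_restore {x s : Fin k} (hxs : x ≠ s) {n : ℕ} (hn : c x + n ≤ bd) :
    (whileDo (decNZ s) (inc x) : Block k α β).Exec w bd ⟨p, Function.update c s n, o⟩ true
      ⟨p, Function.update (Function.update c s 0) x (c x + n), o⟩ := by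
  induction n generalizing c with
  | zero =>
    have hd := exec_decNZ (α := α) (w := w) (bd := bd) (s := ⟨p, Function.update c s 0, o⟩) s
    have h1 : Function.update (Function.update c s 0) x (c x + 0) = Function.update c s 0 := by
      rw [Function.update_eq_self_iff]; simp [hxs]
    rw [h1]
    simp only [Function.update_self, Function.update_idem, ne_eq, not_true, decide_false] at hd
    exact hd.whileDo_false
  | succ n ih =>
    have hd := exec_decNZ (α := α) (w := w) (bd := bd)
      (s := ⟨p, Function.update c s (n + 1), o⟩) s
    simp only [Function.update_self, Function.update_idem, ne_eq, Nat.add_one_ne_zero,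
      not_false_eq_true, decide_true, Nat.add_sub_cancel] at hd
    have hi := exec_inc (α := α) (w := w) (bd := bd)
      (s := ⟨p, Function.update c s n, o⟩) x (by simp [hxs]; omega)
    simp only [Function.update_of_ne hxs] at hi
    have := ih (c := Function.update c x (c x + 1)) (by simp; omega)
    refine hd.whileDo_true hi ?_
    rw [Function.update_comm hxs.symm]
    have h2 : Function.update (Function.update (Function.update c x (c x + 1)) s 0) x
        (Function.update c x (c x + 1) x + n) =
        Function.update (Function.update c s 0) x (c x + (n + 1)) := by
      rw [Function.update_comm hxs, Function.update_idem, Function.update_self,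
        add_assoc, add_comm 1 n]
    rwa [h2] at this

/-- The counters of a `forLoop` with `n` rounds after `j` rounds. -/
def loopCtr (c : Fin k → ℕ) (x s : Fin k) (n j : ℕ) : Fin k → ℕ :=
  Function.update (Function.update c x (n - j)) s j

/-- Throughout the loop the counters `x` and `s` add up to `n`, so the body has access to both the
round number and the bound. The second loop pours `s` back into `x`; as the counters end unchanged,
loops can be nested. -/
theorem Emits.forLoop {x s : Fin k} (hxs : x ≠ s) {n : ℕ} (hx : c x = n) (hs : c s = 0)
    (hn : n ≤ bd) {e : ℕ → List β}
    (hB : ∀ j < n, B.Emits w bd (loopCtr c x s n j) p p (e j)) :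
    (forLoop x s B).Emits w bd c p p ((List.range n).flatMap e) := by
  intro o
  -- Here `d` is the number of rounds still to come; the loop unrolls at its front.
  have key : ∀ d j, j + d = n → ∀ o, (whileDo (nonzero x)
      (Block.seq B (Block.seq (decNZ x) (inc s)))).Exec w bd ⟨p, loopCtr c x s n j, o⟩ true
      ⟨p, loopCtr c x s n n, o ++ (List.range' j d).flatMap e⟩ := by
    intro d
    induction d with
    | zero =>
      intro j hj o
      obtain rfl : j = n := by omega
      have h1 := exec_nonzero (α := α) (β := β) (w := w) (bd := bd) (p := p)
        (c := loopCtr c x s j j) (o := o) x (by simp [loopCtr, hxs])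
      have h2 : loopCtr c x s j j x = 0 := by simp [loopCtr, hxs]
      simp only [h2, ne_eq, not_true, decide_false] at h1
      simpa using h1.whileDo_false
    | succ d ih =>
      intro j hj o
      have h2 : loopCtr c x s n j x = n - j := by simp [loopCtr, hxs]
      have h1 := exec_nonzero (α := α) (β := β) (w := w) (bd := bd) (p := p)
        (c := loopCtr c x s n j) (o := o) x (by omega)
      have h3 : n - j ≠ 0 := by omega
      simp only [h2, ne_eq, h3, not_false_eq_true, decide_true] at h1
      have h4 := exec_decNZ (α := α) (w := w) (bd := bd)
        (s := ⟨p, loopCtr c x s n j, o ++ e j⟩) x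
      have h5 := exec_inc (α := α) (w := w) (bd := bd)
        (s := ⟨p, Function.update (loopCtr c x s n j) x (n - j - 1), o ++ e j⟩) s
        (by simp [hxs.symm, loopCtr]; omega)
      simp only [h2] at h4
      refine h1.whileDo_true (Exec.seq (hB j (by omega) o) (Exec.seq h4 h5)) ?_
      have h6 : Function.update (Function.update (loopCtr c x s n j) x (n - j - 1)) s
          (Function.update (loopCtr c x s n j) x (n - j - 1) s + 1) = loopCtr c x s n (j + 1) := by
        rw [Function.update_of_ne hxs.symm]
        simp only [loopCtr, Function.update_self]
        rw [Function.update_comm hxs.symm, Function.update_idem, Function.update_idem]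
        congr 2
      simp only [h6]
      have := ih (j + 1) (by omega) (o ++ e j)
      rwa [List.append_assoc] at this
  have h1 := key n 0 (by omega) o
  have h0 : loopCtr c x s n 0 = c := by
    funext i
    simp only [loopCtr, Function.update_apply]
    split_ifs with h h'
    · rw [h, hs]
    · rw [h', hx]; rfl
    · rfl
  rw [h0, ← List.range_eq_range'] at h1
  refine Exec.seq h1 ?_
  have h2 := exec_restore (α := α) (β := β) (w := w) (bd := bd) (p := p)
    (o := o ++ (List.range n).flatMap e) (c := Function.update c x (n - n)) hxs
    (n := n) (by simpa using hn)
  have h3 : Function.update (Function.update (Function.update c x (n - n)) s 0) x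
      (Function.update c x (n - n) x + n) = c := by
    funext i
    simp only [Function.update_apply]
    split_ifs with h h'
    · rw [h, hx]; simp
    · rw [h', hs]
    · rfl
  rwa [h3] at h2

end Basic

end Block

/-! ## Programs on circuit words -/

namespace CircuitSymbol

/-- The letters that occur in encoded numbers. -/
def IsNum : CircuitSymbol → Bool
  | tally => true
  | endNum => true
  | _ => false

end CircuitSymbol

theorem encodeNum_add (a b : ℕ) :
    encodeNum (a + b) = List.replicate a CircuitSymbol.tally ++ encodeNum b := by
  rw [encodeNum, ← List.replicate_append_replicate, List.append_assoc, encodeNum]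

theorem isNum_of_mem_encodeNum {a : ℕ} {x : CircuitSymbol} (h : x ∈ encodeNum a) :
    x.IsNum = true := by
  simp only [encodeNum, List.mem_append, List.mem_replicate, List.mem_singleton] at h
  rcases h with ⟨-, rfl⟩ | rfl <;> rfl

theorem encodeNatGate_eq_cons (g : Gate ℕ) :
    ∃ x l, encodeNatGate g = x :: l ∧ x.IsNum = false ∧ ∀ y ∈ l, y.IsNum = true := by
  cases g with
  | negOne => exact ⟨_, _, rfl, rfl, by simp⟩
  | var i => exact ⟨_, _, rfl, rfl, fun y hy => isNum_of_mem_encodeNum hy⟩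
  | add u w =>
    exact ⟨_, _, rfl, rfl, fun y hy => (List.mem_append.1 hy).elim isNum_of_mem_encodeNum
      isNum_of_mem_encodeNum⟩
  | mul u w =>
    exact ⟨_, _, rfl, rfl, fun y hy => (List.mem_append.1 hy).elim isNum_of_mem_encodeNum
      isNum_of_mem_encodeNum⟩

namespace InputCell

/-- The cell holds a tally. -/
def isTally : InputCell CircuitSymbol → Bool
  | letter .tally => true
  | _ => false

/-- The cell holds the end of a number. -/
def isEndNum : InputCell CircuitSymbol → Bool
  | letter .endNum => true
  | _ => false

/-- The cell holds a letter of an encoded number. -/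
def isNum : InputCell CircuitSymbol → Bool
  | letter x => x.IsNum
  | _ => false

/-- The cell holds the label of a constant gate. -/
def isNegOne : InputCell CircuitSymbol → Bool
  | letter .negOne => true
  | _ => false

/-- The cell holds the label of a variable gate. -/
def isVar : InputCell CircuitSymbol → Bool
  | letter .var => true
  | _ => false

/-- The cell holds the label of an addition gate. -/
def isAdd : InputCell CircuitSymbol → Bool
  | letter .add => true
  | _ => false

/-- The cell is not the left end marker. -/
def notLeft {α : Type} : InputCell α → Bool
  | leftEnd => false
  | _ => true

/-- The cell is not the right end marker. -/
def notRight {α : Type} : InputCell α → Bool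
  | rightEnd => false
  | _ => true

end InputCell

namespace SpaceTransducer

variable {α : Type} {w : List α}

theorem inputCell_append (pre : List α) (x : α) (suf : List α) :
    inputCell (pre ++ x :: suf) (pre.length + 1) = .letter x := by
  simp [inputCell]

theorem inputCell_length (w : List α) : inputCell w (w.length + 1) = .rightEnd := by
  simp [inputCell]

theorem notLeft_inputCell_succ (w : List α) (p : ℕ) : (inputCell w (p + 1)).notLeft = true := by
  simp only [inputCell]
  cases w[p]? <;> rfl

end SpaceTransducer

namespace Block

open SpaceTransducer CircuitSymbol

/-- Fragments of the reductions: counter `0` holds the length of the input or counts down from it,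
`1` counts up, `2` is scratch, `3` and `4` are used by the syntax check. -/
abbrev Prog := Block 5 CircuitSymbol CircuitSymbol

variable {w pre suf : List CircuitSymbol} {bd p q : ℕ} {c : Fin 5 → ℕ} {l l' : List CircuitSymbol}

theorem Emits.cast {B : Prog} (h : B.Emits w bd c p q l) {q'} (hq : q = q') (hl : l = l') :
    B.Emits w bd c p q' l' := hq ▸ hl ▸ h

/-- For every tally that is read, run `B`. -/
def tallyLoop (B : Prog) : Prog := whileDo (test InputCell.isTally) (seq B moveRight)

theorem emits_tallyLoop {B : Prog} (hB : ∀ p, B.Emits w bd c p p l) (a : ℕ) (pre : List CircuitSymbol)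
    (hw : w = pre ++ (encodeNum a ++ suf)) :
    (tallyLoop B).Emits w bd c (pre.length + 1) (pre.length + 1 + a)
      (List.replicate a l).flatten := by
  induction a generalizing pre with
  | zero =>
    refine Emits.while_test_false ?_
    rw [hw]
    simp [encodeNum, inputCell_append, InputCell.isTally]
  | succ a ih =>
    have hw' : w = pre ++ tally :: (encodeNum a ++ suf) := by
      rw [hw]; simp [encodeNum, List.replicate_succ]
    have h := ih (pre ++ [tally]) (by rw [hw']; simp)
    have e1 : (pre ++ [tally]).length + 1 = pre.length + 1 + 1 := by simp
    rw [e1] at h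
    refine (Emits.while_test_true ?_ ((hB _).seq (emits_moveRight ?_)) h).cast (by omega) ?_
    · rw [hw', inputCell_append]; rfl
    · rw [hw']; simp
    · simp [List.replicate_succ]

/-- Skip a number. -/
def skipNum : Prog := seq (tallyLoop (ret true)) moveRight

/-- Copy a number to the output. -/
def copyNum : Prog := seq (tallyLoop (emit tally)) (seq (emit endNum) moveRight)

theorem length_lt_of_append {a : ℕ} (hw : w = pre ++ (encodeNum a ++ suf)) :
    pre.length + 1 + a ≤ w.length := by
  rw [hw]; simp [encodeNum]; omega

theorem emits_skipNum (a : ℕ) (hw : w = pre ++ (encodeNum a ++ suf)) :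
    skipNum.Emits w bd c (pre.length + 1) (pre.length + 1 + a + 1) [] :=
  ((emits_tallyLoop (fun _ => emits_ret) a pre hw).seq
    (emits_moveRight (length_lt_of_append hw))).cast rfl (by simp)

theorem emits_copyNum (a : ℕ) (hw : w = pre ++ (encodeNum a ++ suf)) :
    copyNum.Emits w bd c (pre.length + 1) (pre.length + 1 + a + 1) (encodeNum a) :=
  ((emits_tallyLoop (fun _ => emits_emit _) a pre hw).seq
    ((emits_emit _).seq (emits_moveRight (length_lt_of_append hw)))).cast rfl (by
      simp [encodeNum])

/-- Move the input head to the first letter. -/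
def toStart : Prog := seq (whileDo (test InputCell.notLeft) moveLeft) moveRight

theorem emits_toStart : toStart.Emits w bd c p 1 [] := by
  have h : ∀ p, (whileDo (test InputCell.notLeft) moveLeft : Prog).Emits w bd c p 0 [] := by
    intro p
    induction p with
    | zero => exact Emits.while_test_false rfl
    | succ p ih =>
      exact Emits.while_test_true (notLeft_inputCell_succ w p) emits_moveLeft ih
  exact (h p).seq (emits_moveRight (Nat.zero_le _))

/-- Move the input head back to the label of a gate. -/
def backToLabel : Prog := seq moveLeft (whileDo (test InputCell.isNum) moveLeft)

/-- The unconditional first move matters when the head stands just behind the gate, possibly on the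
label of the next one. Allowing every `j` covers an abandoned reading of a number. -/
theorem emits_backToLabel {x : CircuitSymbol} (hx : x.IsNum = false) (hl : ∀ y ∈ l, y.IsNum = true)
    (hw : w = pre ++ (x :: l ++ suf)) {j : ℕ} (hj : j ≤ l.length) :
    backToLabel.Emits w bd c (pre.length + 1 + j + 1) (pre.length + 1) [] := by
  have h : ∀ j ≤ l.length, (whileDo (test InputCell.isNum) moveLeft : Prog).Emits w bd c
      (pre.length + 1 + j) (pre.length + 1) [] := by
    intro j
    induction j with
    | zero =>
      intro _
      refine Emits.while_test_false ?_
      rw [hw]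
      simpa [inputCell, InputCell.isNum] using hx
    | succ j ih =>
      intro hj
      refine Emits.while_test_true ?_ emits_moveLeft (ih (by omega))
      have h1 : w[pre.length + 1 + j]? = some l[j] := by
        rw [hw, List.getElem?_append_right (by omega),
          show pre.length + 1 + j - pre.length = j + 1 by omega]
        simp [List.getElem?_append_left (show j < l.length from hj)]
      rw [← Nat.add_assoc, inputCell, h1]
      exact hl _ (List.getElem_mem _)
  exact emits_moveLeft.seq (h j hj)

/-- Move the input head to the next label, or to the end. -/
def nextLabel : Prog := seq moveRight (whileDo (test InputCell.isNum) moveRight)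

theorem emits_nextLabel {x : CircuitSymbol} (hl : ∀ y ∈ l, y.IsNum = true)
    (hw : w = pre ++ (x :: l ++ suf)) (hs : ∀ y ∈ suf.head?, y.IsNum = false) :
    nextLabel.Emits w bd c (pre.length + 1) (pre.length + 1 + l.length + 1) [] := by
  have h : ∀ d j, j + d = l.length → (whileDo (test InputCell.isNum) moveRight : Prog).Emits w bd c
      (pre.length + 1 + j + 1) (pre.length + 1 + l.length + 1) [] := by
    intro d
    induction d with
    | zero =>
      rintro j hj
      obtain rfl : j = l.length := by omega
      refine Emits.while_test_false ?_
      have h1 : w[pre.length + 1 + l.length]? = suf.head? := by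
        rw [hw, List.getElem?_append_right (by omega),
          show pre.length + 1 + l.length - pre.length = l.length + 1 by omega]
        simp [List.getElem?_append_right, List.head?_eq_getElem?]
      rw [inputCell, h1]
      cases hsuf : suf.head? with
      | none => rfl
      | some y => exact hs y hsuf
    | succ d ih =>
      intro j hj
      have hj' : j < l.length := by omega
      refine Emits.while_test_true ?_ (emits_moveRight ?_) (ih (j + 1) (by omega))
      · have h1 : w[pre.length + 1 + j]? = some l[j] := by
          rw [hw, List.getElem?_append_right (by omega),
            show pre.length + 1 + j - pre.length = j + 1 by omega]
          simp [List.getElem?_append_left, hj']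
        rw [inputCell, h1]
        exact hl _ (List.getElem_mem _)
      · rw [hw]; simp; omega
  exact (emits_moveRight (by rw [hw]; simp)).seq (h l.length 0 (by omega))

/-- Run `B` on every gate. -/
def gateLoop (B : Prog) : Prog := whileDo (test InputCell.notRight) (seq B nextLabel)

/-- `B` has to end on the label where it began; thus one gate can be processed several times in a
row. -/
theorem emits_gateLoop {B : Prog} {e : Gate ℕ → List CircuitSymbol}
    (hB : ∀ pre g suf, w = pre ++ (encodeNatGate g ++ suf) →
      B.Emits w bd c (pre.length + 1) (pre.length + 1) (e g)) (gs : List (Gate ℕ))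
    (pre : List CircuitSymbol) (hw : w = pre ++ gs.flatMap encodeNatGate) :
    (gateLoop B).Emits w bd c (pre.length + 1) (w.length + 1) (gs.flatMap e) := by
  induction gs generalizing pre with
  | nil =>
    have hw' : w = pre := by simpa using hw
    subst hw'
    exact Emits.while_test_false (by rw [inputCell_length]; rfl)
  | cons g gs ih =>
    have hw' : w = pre ++ (encodeNatGate g ++ gs.flatMap encodeNatGate) := by simpa using hw
    obtain ⟨x, l, hg, hx, hl⟩ := encodeNatGate_eq_cons g
    have h := ih (pre ++ encodeNatGate g) (by simpa using hw)
    have hsuf : ∀ y ∈ (gs.flatMap encodeNatGate).head?, y.IsNum = false := by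
      intro y hy
      cases gs with
      | nil => simp at hy
      | cons g' gs =>
        obtain ⟨x', l', hg', hx', -⟩ := encodeNatGate_eq_cons g'
        simp only [List.flatMap_cons, hg', List.cons_append, List.head?_cons, Option.mem_def,
          Option.some_inj] at hy
        exact hy ▸ hx'
    have hnext : nextLabel.Emits w bd c (pre.length + 1) ((pre ++ encodeNatGate g).length + 1) [] :=
      (emits_nextLabel hl (by rw [hw', hg]) hsuf).cast (by simp [hg]; omega) rfl
    have := Emits.while_test_true (f := InputCell.notRight) (by
      rw [hw', hg, List.cons_append, inputCell_append]; rfl) ((hB pre g _ hw').seq hnext) h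
    exact this.cast rfl (by simp)

/-- Process one gate: `V` processes variable gates, and `R` each of the two children. -/
def gateProg (V R : Prog) : Prog :=
  cond (test InputCell.isNegOne) (emit negOne)
    (cond (test InputCell.isVar) V
      (seq (cond (test InputCell.isAdd) (emit add) (emit mul))
        (seq moveRight (seq R (seq R backToLabel)))))

/-- Both reductions have this shape: children are renamed by `ref`, and only variable gates may be
replaced by something else. -/
theorem emits_gateProg {V R : Prog} {e : Gate ℕ → Gate ℕ} {ref : ℕ → ℕ}
    (hneg : e .negOne = .negOne) (hadd : ∀ u v, e (.add u v) = .add (ref u) (ref v))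
    (hmul : ∀ u v, e (.mul u v) = .mul (ref u) (ref v))
    (hV : ∀ pre a suf, w = pre ++ (var :: encodeNum a ++ suf) →
      V.Emits w bd c (pre.length + 1) (pre.length + 1) (encodeNatGate (e (.var a))))
    (hR : ∀ pre u suf, w = pre ++ (encodeNum u ++ suf) →
      R.Emits w bd c (pre.length + 1) (pre.length + 1 + u + 1) (encodeNum (ref u)))
    (pre : List CircuitSymbol) (g : Gate ℕ) (suf : List CircuitSymbol)
    (hw : w = pre ++ (encodeNatGate g ++ suf)) :
    (gateProg V R).Emits w bd c (pre.length + 1) (pre.length + 1) (encodeNatGate (e g)) := by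
  have hbin : ∀ (x : CircuitSymbol) (u v : ℕ), x.IsNum = false →
      w = pre ++ (x :: (encodeNum u ++ encodeNum v) ++ suf) →
      (seq moveRight (seq R (seq R backToLabel)) : Prog).Emits w bd c (pre.length + 1)
        (pre.length + 1) (encodeNum (ref u) ++ encodeNum (ref v)) := by
    intro x u v hx hw
    have h1 := hR (pre ++ [x]) u (encodeNum v ++ suf) (by rw [hw]; simp)
    have h2 := hR (pre ++ [x] ++ encodeNum u) v suf (by rw [hw]; simp)
    have h3 := emits_backToLabel (bd := bd) (c := c) (l := encodeNum u ++ encodeNum v) hx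
      (fun y hy => (List.mem_append.1 hy).elim isNum_of_mem_encodeNum isNum_of_mem_encodeNum)
      hw le_rfl
    have e1 : (pre ++ [x]).length + 1 = pre.length + 1 + 1 := by simp
    have e2 : (pre ++ [x] ++ encodeNum u).length + 1 = (pre ++ [x]).length + 1 + u + 1 := by
      simp [encodeNum]; omega
    have e3 : pre.length + 1 + (encodeNum u ++ encodeNum v).length + 1 =
        (pre ++ [x] ++ encodeNum u).length + 1 + v + 1 := by
      simp [encodeNum]; omega
    rw [e1] at h1
    rw [e2, e1] at h2
    rw [e3, e2, e1] at h3
    exact ((emits_moveRight (by rw [hw]; simp)).seq (h1.seq (h2.seq h3))).cast rfl (by simp)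
  cases g with
  | negOne =>
    have hcell : inputCell w (pre.length + 1) = .letter negOne := by
      rw [hw]; exact inputCell_append _ _ _
    rw [hneg]
    exact Emits.cond_test_true (by rw [hcell]; rfl) (emits_emit _)
  | var a =>
    have hcell : inputCell w (pre.length + 1) = .letter var := by
      rw [hw]; exact inputCell_append _ _ _
    exact Emits.cond_test_false (by rw [hcell]; rfl) (Emits.cond_test_true (by rw [hcell]; rfl)
      (hV pre a suf hw))
  | add u v =>
    have hcell : inputCell w (pre.length + 1) = .letter add := by
      rw [hw]; exact inputCell_append _ _ _
    rw [hadd]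
    exact Emits.cond_test_false (by rw [hcell]; rfl) (Emits.cond_test_false (by rw [hcell]; rfl)
      ((Emits.cond_test_true (by rw [hcell]; rfl) (emits_emit _)).seq (hbin add u v rfl hw)))
  | mul u v =>
    have hcell : inputCell w (pre.length + 1) = .letter mul := by
      rw [hw]; exact inputCell_append _ _ _
    rw [hmul]
    exact Emits.cond_test_false (by rw [hcell]; rfl) (Emits.cond_test_false (by rw [hcell]; rfl)
      ((Emits.cond_test_false (by rw [hcell]; rfl) (emits_emit _)).seq (hbin mul u v rfl hw)))

/-- Copy a variable gate. -/
def copyVar : Prog := seq (emit var) (seq moveRight (seq copyNum backToLabel))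

theorem emits_copyVar {a : ℕ} (hw : w = pre ++ (var :: encodeNum a ++ suf)) :
    copyVar.Emits w bd c (pre.length + 1) (pre.length + 1) (encodeNatGate (.var a)) := by
  have h1 := emits_copyNum (bd := bd) (c := c) (pre := pre ++ [var]) a (by simpa using hw)
  have h2 := emits_backToLabel (bd := bd) (c := c) (x := var) rfl
    (fun y hy => isNum_of_mem_encodeNum hy) hw le_rfl
  have e1 : (pre ++ [var]).length + 1 = pre.length + 1 + 1 := by simp
  have e2 : pre.length + 1 + (encodeNum a).length + 1 = pre.length + 1 + 1 + a + 1 := by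
    simp [encodeNum]; omega
  rw [e1] at h1
  rw [e2] at h2
  exact ((emits_emit _).seq ((emits_moveRight (by rw [hw]; simp)).seq (h1.seq h2))).cast rfl (by
    simp [encodeNatGate])

/-! ### The program for `squareGates` -/

/-- Copy a number, increased by `3`. -/
def shiftNum : Prog := seq (emits (List.replicate 3 tally)) copyNum

theorem emits_shiftNum (a : ℕ) (hw : w = pre ++ (encodeNum a ++ suf)) :
    shiftNum.Emits w bd c (pre.length + 1) (pre.length + 1 + a + 1) (encodeNum (3 + a)) := by
  rw [encodeNum_add]
  exact (emits_emits _).seq (emits_copyNum a hw)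

/-- Emit the word of `squareGates`. -/
def squareProg : Prog :=
  seq toStart
    (seq (emits (encodeNum 2 ++ (encodeNatGate (.var 0) ++ (encodeNatGate (.mul 0 0) ++
        (mul :: encodeNum 1)))))
      (seq shiftNum (gateLoop (gateProg copyVar shiftNum))))

/-- The last new gate `mul 1 (3 + o)` is written only up to its first child; the shifted copy of the
output name, which comes first in the input, supplies the second. -/
theorem emits_squareProg {o : ℕ} {gs : List (Gate ℕ)} (hw : w = encodeGates o gs) :
    squareProg.Emits w bd c p (w.length + 1) (encodeGates 2 (squareGates o gs)) := by
  have h1 := emits_shiftNum (bd := bd) (c := c) (pre := []) o hw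
  have h2 := emits_gateLoop (w := w) (bd := bd) (c := c) (B := gateProg copyVar shiftNum)
    (emits_gateProg (e := Gate.map (3 + ·)) (ref := (3 + ·)) rfl (fun _ _ => rfl) (fun _ _ => rfl)
      (fun _ _ _ h => emits_copyVar h) (fun _ u _ h => emits_shiftNum u h)) gs (encodeNum o) hw
  have e1 : (encodeNum o).length + 1 = ([] : List CircuitSymbol).length + 1 + o + 1 := by
    simp [encodeNum]; omega
  rw [e1] at h2
  refine (emits_toStart.seq ((emits_emits _).seq (h1.seq h2))).cast rfl ?_
  simp [encodeGates, squareGates, List.flatMap_map, encodeNatGate]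

end Block

namespace Block

open SpaceTransducer CircuitSymbol

variable {w pre suf : List CircuitSymbol} {bd p q : ℕ} {c : Fin 5 → ℕ} {l l' : List CircuitSymbol}

/-! ### The program for `defectGates` -/

/-- Emit `a` tallies for every unit of counter `x`. -/
def emitTimes (x : Fin 5) (a : ℕ) : Prog := forLoop x 2 (emits (List.replicate a tally))

/-- The counters `0` and `1` add up to `M`, and the scratch counter is free. -/
structure Ready (c : Fin 5 → ℕ) (bd M : ℕ) : Prop where
  sum : c 0 + c 1 = M
  scratch : c 2 = 0
  le : M ≤ bd

theorem emits_emitTimes {x : Fin 5} (hx : x ≠ 2) (h2 : c 2 = 0) (hb : c x ≤ bd) (a : ℕ) :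
    (emitTimes x a).Emits w bd c p p (List.replicate (a * c x) tally) := by
  refine (Emits.forLoop hx rfl h2 hb fun j _ => emits_emits _).cast rfl ?_
  simp [List.flatMap, List.map_const', mul_comm]

/-- Emit the number `a * c 0 + b * c 1 + d`. -/
def emitLinear (a b d : ℕ) : Prog :=
  seq (emitTimes 0 a) (seq (emitTimes 1 b) (emits (encodeNum d)))

variable {M : ℕ}

theorem emits_emitLinear (hc : Ready c bd M) (a b d : ℕ) :
    (emitLinear a b d).Emits w bd c p p (encodeNum (a * c 0 + b * c 1 + d)) := by
  have h1 := hc.sum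
  have h2 := hc.le
  rw [add_assoc, encodeNum_add, encodeNum_add]
  exact (emits_emitTimes (by decide) hc.scratch (by omega) a).seq
    ((emits_emitTimes (by decide) hc.scratch (by omega) b).seq (emits_emits _))

/-- Read a number `u`, and emit the name of the copy of type `t` of gate `u`. -/
def emitRef (t : ℕ) : Prog :=
  seq (tallyLoop (seq (emitTimes 0 3) (emitTimes 1 3))) (seq (emitLinear 8 11 (3 + t)) moveRight)

/-- Each tally of `u` yields `3 * M` tallies, and with `M = c 0 + c 1` the remainder `3 + 8 * M + 3
* c 1 + t` equals `8 * c 0 + 11 * c 1 + (3 + t)`. -/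
theorem emits_emitRef (hc : Ready c bd M) (t u : ℕ) (hw : w = pre ++ (encodeNum u ++ suf)) :
    (emitRef t).Emits w bd c (pre.length + 1) (pre.length + 1 + u + 1)
      (encodeNum (copyName M u (c 1) t)) := by
  have h1 := hc.sum
  have h2 := hc.le
  refine ((emits_tallyLoop (fun p => (emits_emitTimes (by decide) hc.scratch (by omega) 3).seq
    (emits_emitTimes (by decide) hc.scratch (by omega) 3)) u pre hw).seq
    ((emits_emitLinear hc 8 11 (3 + t)).seq (emits_moveRight (length_lt_of_append hw)))).cast rfl ?_
  rw [List.append_nil, List.replicate_append_replicate, List.flatten_replicate_replicate,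
    ← encodeNum_add]
  congr 1
  rw [copyName, ← h1]
  ring

/-- Count down in counter `1` while reading tallies. -/
def matchLoop : Prog :=
  whileDo (cond (test InputCell.isTally) (decNZ 1) (ret false)) (seq (inc 2) moveRight)

theorem isTally_inputCell {a j : ℕ} (hw : w = pre ++ (encodeNum a ++ suf)) (hj : j ≤ a) :
    (inputCell w (pre.length + 1 + j)).isTally = decide (j < a) := by
  have h : w[pre.length + j]? = some (if j < a then tally else endNum) := by
    rw [hw, List.getElem?_append_right (by omega), Nat.add_sub_cancel_left,
      List.getElem?_append_left (by simp [encodeNum]; omega), encodeNum]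
    by_cases h : j < a
    · simp [List.getElem?_append_left, h]
    · obtain rfl : j = a := by omega
      simp
  rw [show pre.length + 1 + j = pre.length + j + 1 by omega, inputCell, h]
  by_cases h : j < a <;> simp [h, InputCell.isTally]

/-- The index `a` is compared with counter `1` by cancelling tallies against units; they are equal
iff both are exhausted together. Cancelled units go to counter `2`, from where `restore` returns
them. -/
theorem exec_matchLoop (a : ℕ) (pre : List CircuitSymbol) (hw : w = pre ++ (encodeNum a ++ suf))
    (c : Fin 5 → ℕ) (hc : c 1 + c 2 ≤ bd) (o : List CircuitSymbol) :
    matchLoop.Exec w bd ⟨pre.length + 1, c, o⟩ true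
      ⟨pre.length + 1 + min a (c 1),
        Function.update (Function.update c 1 (c 1 - min a (c 1))) 2 (c 2 + min a (c 1)), o⟩ := by
  induction a generalizing pre c with
  | zero =>
    have h1 := exec_test (β := CircuitSymbol) (w := w) (bd := bd) (p := pre.length + 1) (c := c)
      (o := o) InputCell.isTally
    have h2 := isTally_inputCell hw le_rfl
    rw [Nat.add_zero] at h2
    rw [h2] at h1
    simpa [matchLoop] using (Exec.cond_false (B := decNZ 1) h1 (exec_ret false)).whileDo_false
  | succ a ih =>
    have hw' : w = (pre ++ [tally]) ++ (encodeNum a ++ suf) := by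
      rw [hw]; simp [encodeNum, List.replicate_succ]
    have h1 := exec_test (β := CircuitSymbol) (w := w) (bd := bd) (p := pre.length + 1) (c := c)
      (o := o) InputCell.isTally
    have h2 := isTally_inputCell hw (Nat.zero_le _)
    rw [Nat.add_zero] at h2
    rw [h2] at h1
    have hd := exec_decNZ (α := CircuitSymbol) (w := w) (bd := bd)
      (s := ⟨pre.length + 1, c, o⟩) (1 : Fin 5)
    have hcond := h1.cond_true (C := ret false) hd
    by_cases h0 : c 1 = 0
    · simp only [h0, ne_eq, not_true, decide_false] at hcond
      have h3 : Function.update c 1 0 = c := by rw [Function.update_eq_self_iff, h0]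
      simpa [matchLoop, h0, h3] using hcond.whileDo_false
    · simp only [h0, ne_eq, not_false_eq_true, decide_true] at hcond
      have hi := exec_inc (α := CircuitSymbol) (w := w) (bd := bd)
        (s := ⟨pre.length + 1, Function.update c 1 (c 1 - 1), o⟩) (2 : Fin 5) (by simp; omega)
      have := ih (pre ++ [tally]) hw'
        (Function.update (Function.update c 1 (c 1 - 1)) 2 (c 2 + 1)) (by simp; omega)
      have e1 : (pre ++ [tally]).length + 1 = pre.length + 1 + 1 := by simp
      rw [e1] at this
      refine Exec.whileDo_true hcond (Exec.seq hi (exec_moveRight (by rw [hw']; simp))) ?_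
      have e2 : min (a + 1) (c 1) = min a (c 1 - 1) + 1 := by omega
      have e3 : c 1 - (min a (c 1 - 1) + 1) = c 1 - 1 - min a (c 1 - 1) := by omega
      have e4 : c 2 + (min a (c 1 - 1) + 1) = c 2 + 1 + min a (c 1 - 1) := by omega
      have e5 : pre.length + 1 + (min a (c 1 - 1) + 1) = pre.length + 1 + 1 + min a (c 1 - 1) := by
        omega
      rw [e2, e3, e4, e5]
      have h12 : (1 : Fin 5) ≠ 2 := by decide
      simp only [Function.update_of_ne h12, Function.update_of_ne h12.symm,
        Function.update_self] at this ⊢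
      rwa [Function.update_comm h12.symm, Function.update_idem, Function.update_idem] at this

/-- Undo `matchLoop`. -/
def restore : Prog := whileDo (decNZ 2) (inc 1)

/-- Emit `l` if the variable of the gate is the one in counter `1`; copy the gate otherwise. -/
def replaceVar (l : List CircuitSymbol) : Prog :=
  seq moveRight (seq matchLoop
    (cond (cond (test InputCell.isTally) (ret true) (nonzero 1))
      (seq restore (seq backToLabel copyVar)) (seq restore (seq backToLabel (emits l)))))

theorem emits_replaceVar {a : ℕ} (h2 : c 2 = 0) (h1 : c 1 ≤ bd) (l : List CircuitSymbol)
    (hw : w = pre ++ (var :: encodeNum a ++ suf)) :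
    (replaceVar l).Emits w bd c (pre.length + 1) (pre.length + 1)
      (if a = c 1 then l else encodeNatGate (.var a)) := by
  intro o
  have hw' : w = (pre ++ [var]) ++ (encodeNum a ++ suf) := by rw [hw]; simp
  have hm := exec_matchLoop (bd := bd) a (pre ++ [var]) hw' c (by omega) o
  have e1 : (pre ++ [var]).length + 1 = pre.length + 1 + 1 := by simp
  have hcell := isTally_inputCell hw' (min_le_left a (c 1))
  rw [e1] at hm hcell
  rw [h2, Nat.zero_add] at hm
  set n := min a (c 1) with hn
  have hrest : restore.Exec w bd ⟨pre.length + 1 + 1 + n,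
      Function.update (Function.update c 1 (c 1 - n)) 2 n, o⟩ true
      ⟨pre.length + 1 + 1 + n, c, o⟩ := by
    have := exec_restore (α := CircuitSymbol) (w := w) (bd := bd) (p := pre.length + 1 + 1 + n)
      (o := o) (c := Function.update c 1 (c 1 - n)) (x := (1 : Fin 5)) (s := 2) (by decide)
      (n := n) (by simp; omega)
    have e : Function.update (Function.update (Function.update c 1 (c 1 - n)) 2 0) 1
        (Function.update c 1 (c 1 - n) 1 + n) = c := by
      rw [Function.update_comm (by decide), Function.update_idem, Function.update_self,
        Nat.sub_add_cancel (by omega), Function.update_eq_self, ← h2, Function.update_eq_self]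
    rwa [e] at this
  have hback : ∀ {B : Prog} {l}, B.Emits w bd c (pre.length + 1) (pre.length + 1) l →
      (seq restore (seq backToLabel B)).Exec w bd ⟨pre.length + 1 + 1 + n,
      Function.update (Function.update c 1 (c 1 - n)) 2 n, o⟩ true ⟨pre.length + 1, c, o ++ l⟩ := by
    intro B l hB
    have hb := emits_backToLabel (bd := bd) (c := c) (x := var) rfl
      (fun y hy => isNum_of_mem_encodeNum hy) hw (j := n) (by simp [encodeNum]; omega)
    rw [show pre.length + 1 + n + 1 = pre.length + 1 + 1 + n by omega] at hb
    exact Exec.seq hrest ((hb.seq hB) o)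
  have ht := exec_test (β := CircuitSymbol) (w := w) (bd := bd) (p := pre.length + 1 + 1 + n)
    (c := Function.update (Function.update c 1 (c 1 - n)) 2 n) (o := o) InputCell.isTally
  rw [hcell] at ht
  have hz := exec_nonzero (α := CircuitSymbol) (w := w) (bd := bd) (p := pre.length + 1 + 1 + n)
    (c := Function.update (Function.update c 1 (c 1 - n)) 2 n) (o := o) (1 : Fin 5)
    (by simp; omega)
  have h12 : (1 : Fin 5) ≠ 2 := by decide
  simp only [Function.update_of_ne h12, Function.update_self] at hz
  refine Exec.seq (exec_moveRight (by rw [hw]; simp)) (Exec.seq hm ?_)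
  by_cases hlt : n < a
  · simp only [hlt, decide_true] at ht
    have : a ≠ c 1 := by omega
    rw [if_neg this]
    exact Exec.cond_true (Exec.cond_true ht (exec_ret true)) (hback (emits_copyVar hw))
  · simp only [hlt, decide_false] at ht
    have hcond := Exec.cond_false (B := ret true) ht hz
    by_cases h : a = c 1
    · have h' : c 1 - n = 0 := by omega
      simp only [h', ne_eq, not_true, decide_false] at hcond hback ⊢
      rw [if_pos h]
      exact Exec.cond_false hcond (hback (emits_emits l))
    · have h' : c 1 - n ≠ 0 := by omega
      simp only [h', ne_eq, not_false_eq_true, decide_true] at hcond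
      rw [if_neg h]
      exact Exec.cond_true hcond (hback (emits_copyVar hw))

/-- Emit the copy of type `t` of a variable gate. -/
def varProg : Fin 3 → Prog :=
  ![copyVar, replaceVar (encodeNatGate (.add 0 1)), replaceVar (encodeNatGate .negOne)]

theorem emits_varProg {a : ℕ} (hc : Ready c bd M) (t : Fin 3) (ref : ℕ → ℕ)
    (hw : w = pre ++ (var :: encodeNum a ++ suf)) :
    (varProg t).Emits w bd c (pre.length + 1) (pre.length + 1)
      (encodeNatGate (copyGate ref 0 1 (c 1) t (.var a))) := by
  have h1 := hc.sum
  have h2 := hc.le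
  fin_cases t
  · refine (emits_copyVar hw).cast rfl ?_
    by_cases h : a = c 1 <;> simp [copyGate, h]
  · refine (emits_replaceVar hc.scratch (by omega) _ hw).cast rfl ?_
    by_cases h : a = c 1 <;> simp [copyGate, h]
  · refine (emits_replaceVar hc.scratch (by omega) _ hw).cast rfl ?_
    by_cases h : a = c 1 <;> simp [copyGate, h]

/-- Emit the copy of type `t` of a gate. -/
def copyProg (t : Fin 3) : Prog := gateProg (varProg t) (emitRef t)

theorem emits_copyProg (hc : Ready c bd M) (t : Fin 3) (pre : List CircuitSymbol) (g : Gate ℕ)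
    (suf : List CircuitSymbol) (hw : w = pre ++ (encodeNatGate g ++ suf)) :
    (copyProg t).Emits w bd c (pre.length + 1) (pre.length + 1)
      (encodeNatGate (copyGate (fun u => copyName M u (c 1) t) 0 1 (c 1) t g)) :=
  emits_gateProg (e := copyGate (fun u => copyName M u (c 1) t) 0 1 (c 1) t) rfl
    (fun _ _ => rfl) (fun _ _ => rfl) (fun _ _ _ h => emits_varProg hc t _ h)
    (fun _ u _ h => emits_emitRef hc t u h) pre g suf hw

/-- Emit the name of the copy of type `t` of the output gate. -/
def outRef (t : ℕ) : Prog := seq (emitRef t) toStart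

theorem emits_outRef (hc : Ready c bd M) (t : ℕ) {o : ℕ} (hw : w = encodeNum o ++ suf) :
    (outRef t).Emits w bd c 1 1 (encodeNum (copyName M o (c 1) t)) :=
  ((emits_emitRef (pre := []) hc t o hw).seq emits_toStart).cast rfl (by simp)

/-- Emit a gate with the label `x` and two children. -/
def gate₂ (x : CircuitSymbol) (A B : Prog) : Prog := seq (emit x) (seq A B)

theorem Emits.gate₂ {A B : Prog} (hA : A.Emits w bd c p p l) (hB : B.Emits w bd c p p l')
    (x : CircuitSymbol) : (gate₂ x A B).Emits w bd c p p (x :: (l ++ l')) :=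
  (emits_emit x).seq (hA.seq hB)

/-- Emit the gates of the header for one variable. -/
def headerProg : Prog :=
  seq (seq (emit var) (emitLinear 0 1 0))
  (seq (gate₂ mul (emits (encodeNum 0)) (outRef 1))
  (seq (gate₂ add (outRef 0) (emitLinear 0 8 4))
  (seq (gate₂ add (outRef 2) (emitLinear 0 8 4))
  (seq (gate₂ mul (emitLinear 0 8 3) (emitLinear 0 8 6))
  (seq (gate₂ add (emitLinear 0 8 5) (emitLinear 0 8 7))
  (seq (gate₂ mul (emitLinear 0 8 8) (emitLinear 0 8 8))
    (gate₂ add (emitLinear 0 8 9) (emitLinear 0 8 2))))))))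

/-- Names of header gates and of the accumulator are `8 * c 1` plus a constant. For the copies of
the output gate, `outRef` rereads the output name at the beginning of the input and returns there.
-/
theorem emits_headerProg (hc : Ready c bd M) {o : ℕ} (hw : w = encodeNum o ++ suf) :
    headerProg.Emits w bd c 1 1 ((List.ofFn (headerGate (fun t => copyName M o (c 1) t)
      (fun d => 3 + 8 * c 1 + d) 0 (2 + 8 * c 1) (c 1))).flatMap encodeNatGate) := by
  have hl : ∀ {d d' : ℕ}, d = d' → (emitLinear 0 8 d).Emits w bd c 1 1
      (encodeNum (8 * c 1 + d')) := by
    rintro d _ rfl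
    simpa using emits_emitLinear hc 0 8 d
  have hx : (emitLinear 0 1 0).Emits w bd c 1 1 (encodeNum (c 1)) := by
    simpa using emits_emitLinear hc 0 1 0
  have hr := fun t => emits_outRef hc t hw
  refine (((emits_emit var).seq hx).seq
    (((emits_emits _).gate₂ (hr 1) mul).seq
    (((hr 0).gate₂ (hl rfl) add).seq
    (((hr 2).gate₂ (hl rfl) add).seq
    (((hl rfl).gate₂ (hl rfl) mul).seq
    (((hl rfl).gate₂ (hl rfl) add).seq
    (((hl rfl).gate₂ (hl rfl) mul).seq
    ((hl rfl).gate₂ (hl rfl) add)))))))).cast rfl ?_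
  have e : ∀ d, 3 + 8 * c 1 + d = 8 * c 1 + (3 + d) := fun d => by omega
  simp [List.ofFn_succ, headerGate, encodeNatGate, e, add_comm 2]

theorem Ready.loopCtr (h2 : c 2 = 0) (hM : M ≤ bd) {j : ℕ}
    (hj : j < M) : Ready (loopCtr c 0 1 M j) bd M := by
  refine ⟨?_, ?_, hM⟩
  · simp [Block.loopCtr]; omega
  · simp [Block.loopCtr, h2]

theorem loopCtr_one (c : Fin 5 → ℕ) (j : ℕ) : loopCtr c 0 1 M j 1 = j := by
  simp [loopCtr]

/-- Emit the word of `defectGates`. -/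
def defectProg : Prog :=
  seq toStart (seq (emitLinear 8 8 2)
    (seq (emits ((List.ofFn (constGate 0 1)).flatMap encodeNatGate))
      (seq (forLoop 0 1 headerProg)
        (seq skipNum
          (gateLoop (forLoop 0 1 (seq (copyProg 0) (seq (copyProg 1) (copyProg 2)))))))))

/-- The output name is skipped only after all headers are written, since each header reads it again.
-/
theorem emits_defectProg {o : ℕ} {gs : List (Gate ℕ)} (hw : w = encodeGates o gs)
    (h0 : c 0 = M) (h1 : c 1 = 0) (h2 : c 2 = 0) (hM : M ≤ bd) :
    defectProg.Emits w bd c p (w.length + 1)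
      (encodeGates (2 + 8 * M) (defectGates M o gs)) := by
  have hready := fun {j} (hj : j < M) => Ready.loopCtr h2 hM hj
  have hc : Ready c bd M := ⟨by omega, h2, hM⟩
  have hhead := Emits.forLoop (c := c) (x := 0) (s := 1) (by decide) h0 h1 hM
    fun j hj => emits_headerProg (hready hj) hw
  have hskip := emits_skipNum (pre := []) (bd := bd) (c := c) o hw
  have hgates := emits_gateLoop (w := w) (bd := bd) (c := c)
    (fun pre g suf hw => Emits.forLoop (c := c) (x := 0) (s := 1) (by decide) h0 h1 hM
      fun j hj => ((emits_copyProg (hready hj) 0 pre g suf hw).seq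
        ((emits_copyProg (hready hj) 1 pre g suf hw).seq
          (emits_copyProg (hready hj) 2 pre g suf hw)))) gs (encodeNum o) hw
  have e1 : (encodeNum o).length + 1 = ([] : List CircuitSymbol).length + 1 + o + 1 := by
    simp [encodeNum]; omega
  rw [e1] at hgates
  refine (emits_toStart.seq ((emits_emitLinear hc 8 8 2).seq ((emits_emits _).seq
    (hhead.seq (hskip.seq hgates))))).cast rfl ?_
  have e2 : 8 * c 0 + 8 * c 1 + 2 = 2 + 8 * M := by omega
  simp only [loopCtr_one, e2, encodeGates, defectGates, List.flatMap_append, List.flatMap_assoc,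
    List.nil_append]
  simp [List.ofFn_succ]

end Block

/-! ## The syntax check -/

open CircuitSymbol

/-- The syntax check counts the numbers that are still to come, and the errors. -/
def scanStep : ℕ × ℕ → CircuitSymbol → ℕ × ℕ
  | (n + 1, e), tally => (n + 1, e)
  | (n + 1, e), endNum => (n, e)
  | (n + 1, e), _ => (n + 1, e + 1)
  | (0, e), negOne => (0, e)
  | (0, e), var => (1, e)
  | (0, e), add => (2, e)
  | (0, e), mul => (2, e)
  | (0, e), _ => (0, e + 1)

theorem snd_le_scanStep (s : ℕ × ℕ) (x : CircuitSymbol) :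
    s.2 ≤ (scanStep s x).2 ∧ (scanStep s x).2 ≤ s.2 + 1 := by
  rcases s with ⟨_ | n, e⟩ <;> cases x <;> simp [scanStep]

theorem fst_scanStep_le {s : ℕ × ℕ} (h : s.1 ≤ 2) (x : CircuitSymbol) :
    (scanStep s x).1 ≤ 2 := by
  rcases s with ⟨_ | n, e⟩ <;> cases x <;> simp_all [scanStep]; omega

/-- Errors are never forgotten, so a final count of zero excludes them at every letter. -/
theorem snd_le_foldl_scanStep (w : List CircuitSymbol) (s : ℕ × ℕ) :
    s.2 ≤ (w.foldl scanStep s).2 := by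
  induction w generalizing s with
  | nil => exact le_rfl
  | cons x w ih => exact (snd_le_scanStep s x).1.trans (ih _)

theorem foldl_scanStep_encodeNum (n e a : ℕ) :
    (encodeNum a).foldl scanStep (n + 1, e) = (n, e) := by
  induction a with
  | zero => rfl
  | succ a ih => simpa [encodeNum, List.replicate_succ, scanStep] using ih

theorem foldl_scanStep_encodeNatGate (e : ℕ) (g : Gate ℕ) :
    (encodeNatGate g).foldl scanStep (0, e) = (0, e) := by
  cases g with
  | negOne => rfl
  | var a => exact foldl_scanStep_encodeNum 0 e a
  | add u v =>
    rw [encodeNatGate, List.foldl_cons, List.foldl_append]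
    exact (congrArg (List.foldl scanStep · (encodeNum v)) (foldl_scanStep_encodeNum 1 e u)).trans
      (foldl_scanStep_encodeNum 0 e v)
  | mul u v =>
    rw [encodeNatGate, List.foldl_cons, List.foldl_append]
    exact (congrArg (List.foldl scanStep · (encodeNum v)) (foldl_scanStep_encodeNum 1 e u)).trans
      (foldl_scanStep_encodeNum 0 e v)

theorem foldl_scanStep_encodeGates (o : ℕ) (gs : List (Gate ℕ)) :
    (encodeGates o gs).foldl scanStep (1, 0) = (0, 0) := by
  rw [encodeGates, List.foldl_append, foldl_scanStep_encodeNum]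
  induction gs with
  | nil => rfl
  | cons g gs ih => rw [List.flatMap_cons, List.foldl_append, foldl_scanStep_encodeNatGate, ih]

/-- With `n` pending numbers allowed, the claim is an induction on the word: a tally lengthens the
first pending number, a terminator is a pending zero, and a label takes the numbers pending after it
as its operands. -/
theorem exists_of_foldl_scanStep (w : List CircuitSymbol) (n : ℕ)
    (h : w.foldl scanStep (n, 0) = (0, 0)) : ∃ (l : List ℕ) (gs : List (Gate ℕ)),
      l.length = n ∧ w = l.flatMap encodeNum ++ gs.flatMap encodeNatGate := by
  induction w generalizing n with
  | nil =>
    obtain rfl : n = 0 := by simpa using h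
    exact ⟨[], [], rfl, rfl⟩
  | cons x w ih =>
    rw [List.foldl_cons] at h
    have herr : (scanStep (n, 0) x).2 = 0 :=
      Nat.le_zero.1 ((snd_le_foldl_scanStep w _).trans_eq (by rw [h]))
    cases n with
    | zero =>
      cases x <;> simp only [scanStep, Nat.zero_add, one_ne_zero] at h herr
      · obtain ⟨l, gs, hl, rfl⟩ := ih 0 h
        obtain rfl := List.length_eq_zero_iff.1 hl
        exact ⟨[], .negOne :: gs, rfl, rfl⟩
      · obtain ⟨l, gs, hl, rfl⟩ := ih 1 h
        obtain ⟨a, rfl⟩ := List.length_eq_one_iff.1 hl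
        exact ⟨[], .var a :: gs, rfl, by simp [encodeNatGate]⟩
      · obtain ⟨l, gs, hl, rfl⟩ := ih 2 h
        obtain ⟨a, b, rfl⟩ := List.length_eq_two.1 hl
        exact ⟨[], .add a b :: gs, rfl, by simp [encodeNatGate]⟩
      · obtain ⟨l, gs, hl, rfl⟩ := ih 2 h
        obtain ⟨a, b, rfl⟩ := List.length_eq_two.1 hl
        exact ⟨[], .mul a b :: gs, rfl, by simp [encodeNatGate]⟩
    | succ n =>
      cases x <;> simp only [scanStep, Nat.zero_add, one_ne_zero] at h herr
      · obtain ⟨l, gs, hl, rfl⟩ := ih (n + 1) h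
        obtain ⟨a, l, rfl⟩ := List.exists_cons_of_length_eq_add_one hl
        exact ⟨(a + 1) :: l, gs, by simpa using hl, by simp [encodeNum, List.replicate_succ]⟩
      · obtain ⟨l, gs, hl, rfl⟩ := ih n h
        exact ⟨0 :: l, gs, by simp [hl], by simp [encodeNum]⟩

namespace Block

open SpaceTransducer

variable {w pre suf : List CircuitSymbol} {bd p q : ℕ}

/-- Update counters `3` and `4` by `scanStep`. -/
def scanProg : Prog :=
  cond (test InputCell.isTally) (cond (nonzero 3) (ret true) (inc 4))
  (cond (test InputCell.isEndNum) (cond (decNZ 3) (ret true) (inc 4))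
  (cond (nonzero 3) (inc 4)
  (cond (test InputCell.isNegOne) (ret true)
  (cond (test InputCell.isVar) (inc 3) (seq (inc 3) (inc 3))))))

/-- The counters during the syntax check. -/
def scanCtr (m : ℕ) (s : ℕ × ℕ) : Fin 5 → ℕ := ![m, 0, 0, s.1, s.2]

theorem update_scanCtr_zero (m : ℕ) (s : ℕ × ℕ) (x : ℕ) :
    Function.update (scanCtr m s) 0 x = scanCtr x s := by
  funext i; fin_cases i <;> rfl

theorem update_scanCtr_three (m : ℕ) (s : ℕ × ℕ) (x : ℕ) :
    Function.update (scanCtr m s) 3 x = scanCtr m (x, s.2) := by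
  funext i; fin_cases i <;> rfl

theorem update_scanCtr_four (m : ℕ) (s : ℕ × ℕ) (x : ℕ) :
    Function.update (scanCtr m s) 4 x = scanCtr m (s.1, x) := by
  funext i; fin_cases i <;> rfl

theorem exec_scanProg (m n e : ℕ) (hn : n ≤ bd) (hbd : 2 ≤ bd) (he : e + 1 ≤ bd)
    (x : CircuitSymbol) (hx : inputCell w p = .letter x) (o : List CircuitSymbol) :
    scanProg.Exec w bd ⟨p, scanCtr m (n, e), o⟩ true ⟨p, scanCtr m (scanStep (n, e) x), o⟩ := by
  have hz := exec_nonzero (α := CircuitSymbol) (β := CircuitSymbol) (w := w) (bd := bd) (p := p)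
    (c := scanCtr m (n, e)) (o := o) 3 hn
  have hd := exec_decNZ (α := CircuitSymbol) (β := CircuitSymbol) (w := w) (bd := bd)
    (s := ⟨p, scanCtr m (n, e), o⟩) 3
  have hi3 := fun n (h : n + 1 ≤ bd) => exec_inc (α := CircuitSymbol) (β := CircuitSymbol) (w := w) (bd := bd)
    (s := ⟨p, scanCtr m (n, e), o⟩) 3 h
  have hi4 := exec_inc (α := CircuitSymbol) (β := CircuitSymbol) (w := w) (bd := bd)
    (s := ⟨p, scanCtr m (n, e), o⟩) 4 he
  have ht := fun f => exec_test (β := CircuitSymbol) (w := w) (bd := bd) (p := p)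
    (c := scanCtr m (n, e)) (o := o) f
  simp only [update_scanCtr_three] at hd hi3
  simp only [update_scanCtr_four] at hi4
  simp only [hx] at ht
  have hr := exec_ret (α := CircuitSymbol) (β := CircuitSymbol) (w := w) (bd := bd) (p := p)
    (c := scanCtr m (n, e)) (o := o) true
  cases n with
  | zero =>
    cases x
    · exact Exec.cond_true (ht _) (Exec.cond_false hz hi4)
    · exact Exec.cond_false (ht _) (Exec.cond_true (ht _) (Exec.cond_false hd hi4))
    · exact Exec.cond_false (ht _) (Exec.cond_false (ht _) (Exec.cond_false hz
        (Exec.cond_true (ht _) hr)))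
    · exact Exec.cond_false (ht _) (Exec.cond_false (ht _) (Exec.cond_false hz
        (Exec.cond_false (ht _) (Exec.cond_true (ht _) (hi3 0 (by omega))))))
    · exact Exec.cond_false (ht _) (Exec.cond_false (ht _) (Exec.cond_false hz
        (Exec.cond_false (ht _) (Exec.cond_false (ht _)
          (Exec.seq (hi3 0 (by omega)) (hi3 1 hbd))))))
    · exact Exec.cond_false (ht _) (Exec.cond_false (ht _) (Exec.cond_false hz
        (Exec.cond_false (ht _) (Exec.cond_false (ht _)
          (Exec.seq (hi3 0 (by omega)) (hi3 1 hbd))))))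
  | succ n =>
    cases x
    · exact Exec.cond_true (ht _) (Exec.cond_true hz hr)
    · exact Exec.cond_false (ht _) (Exec.cond_true (ht _) (Exec.cond_true hd (exec_ret true)))
    all_goals
      exact Exec.cond_false (ht _) (Exec.cond_false (ht _) (Exec.cond_true hz hi4))

/-- Check the syntax and compute the length of the input. -/
def checkProg : Prog :=
  seq (inc 3) (seq moveRight
    (whileDo (test InputCell.notRight) (seq (inc 0) (seq scanProg moveRight))))

/-- At most two numbers are ever pending and there are at most as many errors as letters, which is
why the bound `w.length + 2` suffices even for short words. -/
theorem exec_checkProg (w : List CircuitSymbol) :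
    checkProg.Exec w (w.length + 2) ⟨0, 0, []⟩ true
      ⟨w.length + 1, scanCtr w.length (w.foldl scanStep (1, 0)), []⟩ := by
  have hloop : ∀ (suf pre : List CircuitSymbol), w = pre ++ suf → ∀ s : ℕ × ℕ, s.1 ≤ 2 →
      s.2 ≤ pre.length →
      (whileDo (test InputCell.notRight) (seq (inc 0) (seq scanProg moveRight)) : Prog).Exec w
        (w.length + 2) ⟨pre.length + 1, scanCtr pre.length s, []⟩ true
        ⟨w.length + 1, scanCtr w.length (suf.foldl scanStep s), []⟩ := by
    intro suf
    induction suf with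
    | nil =>
      intro pre hw s _ _
      obtain rfl : w = pre := by simpa using hw
      have ht := exec_test (β := CircuitSymbol) (w := w) (bd := w.length + 2)
        (p := w.length + 1) (c := scanCtr w.length s) (o := []) InputCell.notRight
      rw [inputCell_length] at ht
      exact ht.whileDo_false
    | cons x suf ih =>
      intro pre hw s h1 h2
      have hcell : inputCell w (pre.length + 1) = .letter x := by
        rw [hw]; exact inputCell_append _ _ _
      have hlen : w.length = pre.length + (suf.length + 1) := by rw [hw]; simp
      have ht := exec_test (β := CircuitSymbol) (w := w) (bd := w.length + 2)
        (p := pre.length + 1) (c := scanCtr pre.length s) (o := []) InputCell.notRight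
      rw [hcell] at ht
      have hi := exec_inc (α := CircuitSymbol) (β := CircuitSymbol) (w := w) (bd := w.length + 2)
        (s := ⟨pre.length + 1, scanCtr pre.length s, []⟩) 0
        (show pre.length + 1 ≤ w.length + 2 by omega)
      simp only [update_scanCtr_zero] at hi
      have hs := exec_scanProg (bd := w.length + 2) (pre.length + 1) s.1 s.2 (by omega) (by omega)
        (by omega) x hcell []
      have hrec := ih (pre ++ [x]) (by rw [hw]; simp) (scanStep s x) (fst_scanStep_le h1 x)
        (by have := (snd_le_scanStep s x).2; simp; omega)
      rw [List.length_append, List.length_singleton] at hrec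
      exact Exec.whileDo_true ht (Exec.seq hi (Exec.seq hs (exec_moveRight (by omega)))) hrec
  -- The single number pending at the start is the name of the output gate.
  have hi := exec_inc (α := CircuitSymbol) (β := CircuitSymbol) (w := w) (bd := w.length + 2)
    (s := ⟨0, 0, []⟩) (3 : Fin 5) (by simp)
  have h0 : Function.update (0 : Fin 5 → ℕ) 3 1 = scanCtr 0 (1, 0) := by
    funext i; fin_cases i <;> rfl
  simp only [Pi.zero_apply, Nat.zero_add, h0] at hi
  exact Exec.seq hi (Exec.seq (exec_moveRight (Nat.zero_le _))
    (hloop w [] rfl (1, 0) (by norm_num) le_rfl))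

/-- Check the syntax, and run `B` if there are no errors. -/
def checked (B : Prog) : Prog :=
  seq checkProg (cond (nonzero 3) (ret true) (cond (nonzero 4) (ret true) B))

/-- Only the shape of the word is decided here; whether the gates form a circuit is left to the
translation. -/
theorem exec_checked {B : Prog} {F : ℕ → List (Gate ℕ) → List CircuitSymbol}
    (hB : ∀ o gs, ∃ q, B.Emits (encodeGates o gs) ((encodeGates o gs).length + 2)
      (scanCtr (encodeGates o gs).length (0, 0)) ((encodeGates o gs).length + 1) q (F o gs))
    (w : List CircuitSymbol) :
    ∃ s, (checked B).Exec w (w.length + 2) ⟨0, 0, []⟩ true s ∧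
      ((∃ o gs, w = encodeGates o gs ∧ s.out = F o gs) ∨
        (∀ o gs, w ≠ encodeGates o gs) ∧ s.out = []) := by
  have hc := exec_checkProg w
  have hbad : ∀ n e, w.foldl scanStep (1, 0) = (n, e) → (n, e) ≠ (0, 0) →
      ∀ o gs, w ≠ encodeGates o gs := by
    rintro n e h hne o gs rfl
    exact hne (h ▸ foldl_scanStep_encodeGates o gs)
  have hb1 : ∀ (u : List CircuitSymbol) (s : ℕ × ℕ), s.1 ≤ 2 → s.2 + u.length ≤ w.length →
      (u.foldl scanStep s).1 ≤ 2 ∧ (u.foldl scanStep s).2 ≤ w.length := by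
    intro u
    induction u with
    | nil => exact fun s h1 h2 => ⟨h1, h2⟩
    | cons x u ih =>
      intro s h1 h2
      rw [List.length_cons] at h2
      exact ih _ (fst_scanStep_le h1 x) (by have := (snd_le_scanStep s x).2; omega)
  have hb := hb1 w (1, 0) (by norm_num) (by simp)
  rcases hs : w.foldl scanStep (1, 0) with ⟨n, e⟩
  rw [hs] at hc hb
  have hz3 := exec_nonzero (α := CircuitSymbol) (β := CircuitSymbol) (w := w) (bd := w.length + 2)
    (p := w.length + 1) (c := scanCtr w.length (n, e)) (o := []) 3
    (show n ≤ w.length + 2 from by simp only at hb; omega)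
  have hz4 := exec_nonzero (α := CircuitSymbol) (β := CircuitSymbol) (w := w) (bd := w.length + 2)
    (p := w.length + 1) (c := scanCtr w.length (n, e)) (o := []) 4
    (show e ≤ w.length + 2 from by simp only at hb; omega)
  rcases n with _ | n
  · rcases e with _ | e
    · obtain ⟨l, gs, hl, hw⟩ := exists_of_foldl_scanStep w 1 hs
      obtain ⟨o, rfl⟩ := List.length_eq_one_iff.1 hl
      obtain rfl : w = encodeGates o gs := by simpa [encodeGates] using hw
      obtain ⟨q, hq⟩ := hB o gs
      exact ⟨_, Exec.seq hc (Exec.cond_false hz3 (Exec.cond_false hz4 (hq []))),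
        .inl ⟨o, gs, rfl, rfl⟩⟩
    · exact ⟨_, Exec.seq hc (Exec.cond_false hz3 (Exec.cond_true hz4 (exec_ret true))),
        .inr ⟨hbad _ _ hs (by simp), rfl⟩⟩
  · exact ⟨_, Exec.seq hc (Exec.cond_true hz3 (exec_ret true)), .inr ⟨hbad _ _ hs (by simp), rfl⟩⟩

end Block

/-! ## The reductions -/

/-- The code of a circuit contains at least the terminator of its output name, so the empty word is
a non-member that can serve as the image of all ill-formed words. -/
theorem logspaceReducible_of_prog {p q : MvPolynomial ℕ ℤ → Prop} (B : Block.Prog)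
    (F : ℕ → List (Gate ℕ) → List CircuitSymbol)
    (hB : ∀ o gs, ∃ r, B.Emits (encodeGates o gs) ((encodeGates o gs).length + 2)
      (Block.scanCtr (encodeGates o gs).length (0, 0)) ((encodeGates o gs).length + 1) r (F o gs))
    (hF : ∀ o gs, encodeGates o gs ∈ circuitLanguage p ↔ F o gs ∈ circuitLanguage q) :
    LogspaceReducible (circuitLanguage p) (circuitLanguage q) := by
  choose s hs hout using Block.exec_checked hB
  refine ⟨fun w => (s w).out, (Block.checked B).logspaceComputable _
    fun w => ⟨true, s w, hs w, rfl⟩, fun w => ?_⟩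
  rcases hout w with ⟨o, gs, hw, ho⟩ | ⟨hw, ho⟩
  · simp only [ho]
    rw [hw]
    exact hF o gs
  · simp only [ho]
    constructor
    · rintro ⟨C, hC, -⟩
      exact absurd (hC.symm.trans C.encode_eq) (hw _ _)
    · rintro ⟨C, hC, -⟩
      rw [C.encode_eq] at hC
      simp [encodeGates, encodeNum] at hC

theorem length_encodeGates_pos (o : ℕ) (gs : List (Gate ℕ)) : 0 < (encodeGates o gs).length := by
  simp [encodeGates, encodeNum]

theorem lt_length_encodeGates {o a : ℕ} {gs : List (Gate ℕ)} (h : Gate.var a ∈ gs) :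
    a < (encodeGates o gs).length := by
  obtain ⟨gs₁, gs₂, rfl⟩ := List.append_of_mem h
  simp [encodeGates, encodeNatGate, encodeNum]
  omega

theorem proposition3 : LogspaceEquivalent CheckML ACIT := by
  constructor
  · exact logspaceReducible_of_prog (p := IsMultilinearPoly) (q := (· = 0)) Block.defectProg
      (fun o gs => encodeGates (2 + 8 * (encodeGates o gs).length)
        (defectGates (encodeGates o gs).length o gs))
      (fun o gs => ⟨_, Block.emits_defectProg rfl rfl rfl rfl (Nat.le_add_right _ _)⟩)
      (fun o gs => mem_CheckML_iff_defectGates (length_encodeGates_pos o gs)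
        fun a ha => lt_length_encodeGates ha)
  · exact logspaceReducible_of_prog (p := (· = 0)) (q := IsMultilinearPoly) Block.squareProg
      (fun o gs => encodeGates 2 (squareGates o gs))
      (fun o gs => ⟨_, Block.emits_squareProg rfl⟩) mem_ACIT_iff_squareGates
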